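/- Consider a simple undirected graph $G$ on $n\ge 2$ vertices. Each vertex has a distinct ID of $b\le d\log n$ bits, where $d$ is a constant, and knows only its own ID, the IDs of its neighbors, $n$ and $b$. Vertices have private randomness only: each vertex sends the referee a single message, drawn from a distribution depending only on what the vertex knows, and the messages of different vertices are independent. From the messages (knowing which vertex sent which) the referee outputs a set of edges; the protocol succeeds on $G$ if this is the edge set of a spanning forest of $G$, i.e. of an acyclic subgraph of $G$ with the same vertices and the same connected components as $G$. An assignment of $\ell$-bit names $x(e)\in\{0,1\}^\ell$ to all edges $e$ of the complete graph on all possible IDs is called $r$-resilient if $\bigoplus_{e\in A}x(e)\ne\bigoplus_{e\in B}x(e)$ for any two different sets $A\neq B$ of edges with $|A|,|B|\le r$. In the $(k,r)$-protocol the vertices agree in advance on $r$-resilient edge names, and the message of each vertex $v$ encodes, as a bit string of fixed length, (1) a uniformly random set of $\min\{k,\deg(v)\}$ of the edges incident to $v$, and (2) $\bigoplus_{e\ni v}x(e)$, the XOR of the names of all edges of $G$ incident to $v$. 1. There is a constant $c_0$ such that for every constant $c\ge c_0$, with $k=\lceil\sqrt n\,\rceil$ and $r=\lceil c\sqrt n\,\rceil$,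 there are $r$-resilient edge names, an injective encoding of the messages and a referee (all depending only on $n$, $b$, $c$, $d$) such that every vertex sends $O(\sqrt n\log n)$ bits and, for every such graph $G$, the $(k,r)$-protocol succeeds on $G$ with probability at least $1/2$. 2. For every $\alpha>0$ there is a constant $a_0$ such that for every constant $a\ge a_0$, with $k=r=\lceil a\sqrt{n\log n}\,\rceil$, there are $r$-resilient edge names, an injective encoding of the messages and a referee (all depending only on $n$, $b$, $a$, $d$, $\alpha$) such that every vertex sends $O(\sqrt{n\log n}\cdot\log n)$ bits and, for every such graph $G$, the $(k,r)$-protocol succeeds on $G$ with probability at least $1-n^{-\alpha}$. The constants $c_0$ and $a_0$ are absolute and dependent only on $\alpha$, respectively; the constants hidden in the $O(\cdot)$ depend only on $c,d$ in part 1 and on $\alpha,a,d$ in part 2. -/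

import Mathlib

open scoped ENNReal

/-- The identifier of a vertex: a string of `b` bits. -/
abbrev VertexId (b : ℕ) : Type := Fin b → Bool

/-- `T` is a spanning forest of `G`: an acyclic subgraph of `G` on the same vertices, with the same
connected components. -/
def IsSpanningForest {V : Type*} (G T : SimpleGraph V) : Prop :=
  T ≤ G ∧ T.IsAcyclic ∧ ∀ u v, G.Reachable u v → T.Reachable u v

/-- The identifiers of the neighbours of `v`. The vertices of the graph are identified with their
identifiers, so the vertex set is a finite set `V` of identifiers. -/
noncomputable def neighborIds {b : ℕ} {V : Finset (VertexId b)} (G : SimpleGraph V) (v : V) :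
    Finset (VertexId b) := by
  classical exact (G.neighborFinset v).map (Function.Embedding.subtype _)

/-- A one-way protocol with private randomness. Vertices have `b`-bit identifiers, and each vertex
sends `L` bits. A vertex knows only its own identifier and the set of the identifiers of its
neighbours, and draws its message from a distribution that depends on nothing else. The referee sees
who sent which message (`none`: there is no such vertex) and outputs a set of edges, each given by
the identifiers of its two endpoints. -/
structure OneWayProtocol (b L : ℕ) where
  /-- the distribution of the message, given own identifier and identifiers of the neighbours -/
  message : VertexId b → Finset (VertexId b) → PMF (Fin L → Bool)
  /-- the output, given the received messages -/
  referee : (VertexId b → Option (Fin L → Bool)) → Finset (Sym2 (VertexId b))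

namespace OneWayProtocol

variable {b L : ℕ}

/-- The referee's output when the vertices `v ∈ V` send the messages `m v`. -/
def output (P : OneWayProtocol b L) {V : Finset (VertexId b)} (m : V → Fin L → Bool) :
    Finset (Sym2 (VertexId b)) :=
  P.referee fun i => if h : i ∈ V then some (m ⟨i, h⟩) else none

/-- The joint distribution of the messages: the coins of different vertices are independent. -/
noncomputable def messageLaw (P : OneWayProtocol b L) {V : Finset (VertexId b)}
    (G : SimpleGraph V) : MeasureTheory.Measure (V → Fin L → Bool) :=
  MeasureTheory.Measure.pi fun v => (P.message v (neighborIds G v)).toMeasure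

/-- The probability that the referee outputs (the edge set of) a spanning forest of `G`. -/
noncomputable def successProb (P : OneWayProtocol b L) {V : Finset (VertexId b)}
    (G : SimpleGraph V) : ℝ≥0∞ :=
  P.messageLaw G {m | ∃ T : SimpleGraph V, IsSpanningForest G T ∧
    (P.output m : Set (Sym2 (VertexId b))) = Sym2.map Subtype.val '' T.edgeSet}

end OneWayProtocol

/-- Edge names of length `l`: every pair of identifiers gets a string of `l` bits. Bits are elements
of `ZMod 2`, so that the exclusive or is the sum. -/
abbrev EdgeNames (b l : ℕ) : Type := Sym2 (VertexId b) → Fin l → ZMod 2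

/-- The names are `r`-resilient: different sets of at most `r` potential edges (edges of the complete
graph on all identifiers) have different exclusive ors. -/
def EdgeNames.IsResilient {b l : ℕ} (x : EdgeNames b l) (r : ℕ) : Prop :=
  ∀ A B : Finset (Sym2 (VertexId b)),
    A ⊆ (⊤ : SimpleGraph (VertexId b)).edgeFinset → B ⊆ (⊤ : SimpleGraph (VertexId b)).edgeFinset →
    A.card ≤ r → B.card ≤ r → A ≠ B → ∑ e ∈ A, x e ≠ ∑ e ∈ B, x e

/-- The edges incident to the vertex with identifier `i` and set `N` of neighbours. -/
def incidentEdges {b : ℕ} (i : VertexId b) (N : Finset (VertexId b)) :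
    Finset (Sym2 (VertexId b)) :=
  N.image fun j => s(i, j)

/-- The sample of a vertex in the `k`-out model: a uniformly random set of `min k (deg)` of its
incident edges `E`. -/
noncomputable def kOutSample {b : ℕ} (k : ℕ) (E : Finset (Sym2 (VertexId b))) :
    PMF (Finset (Sym2 (VertexId b))) :=
  PMF.uniformOfFinset (E.powersetCard (min k E.card))
    (Finset.powersetCard_nonempty.2 (min_le_right _ _))

/-- The protocol in which every vertex sends two things, encoded by `enc` as a string of `L` bits:
a `k`-out sample of its incident edges, and the exclusive or of the names of all of them. -/
noncomputable def sampleXorProtocol {b l L : ℕ} (k : ℕ) (x : EdgeNames b l)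
    (enc : Finset (Sym2 (VertexId b)) × (Fin l → ZMod 2) → Fin L → Bool)
    (referee : (VertexId b → Option (Fin L → Bool)) → Finset (Sym2 (VertexId b))) :
    OneWayProtocol b L where
  message i N := (kOutSample k (incidentEdges i N)).map fun S =>
    enc (S, ∑ e ∈ incidentEdges i N, x e)
  referee := referee

/-!
Let `H` be the graph of the sampled edges. An edge of `G` is *crossing* if it joins two connected
components of `H`. For a component `S` of `H`, the sum of the messages' exclusive ors over the
vertices of `S` is the exclusive or of the names of the edges leaving `S`, because edges inside `S`
cancel (`sum_edgesAt_eq_sum_boundary`). If there are at most `r` crossing edges, resilience identifies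
the edges leaving each `S`, hence all crossing edges (`crossGraph_le_of_sum_eq`). The sampled and the
crossing edges together have the same components as `G`, so the referee can output a spanning forest.
It remains to show that the samples leave few crossing edges.

Let the vertices draw their samples one edge at a time, in any order. Number the vertices by
increasing degree, call the last vertex of each component of the current `H` its leader, and let the
potential be the sum of the degrees of the leaders. Suppose that `v` draws an edge and that `c` of the
edges from `v` to later vertices are crossing. Each of them is drawn with probability at least
`1 / deg v`, and then two components merge and one leader, of degree at least `deg v`, is lost
(`potential_add_deg_le`). So the potential drops by `c` or more in expectation; as its drops are
sums of degrees, bounded by `n`, this holds with exponential tails at the scale `n`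
(`expect_sampleRun_le_one`). If every vertex draws `m` edges and `X` crossing edges are left in the
end, at least `m * X` is collected along the way, whence `m * X = O(potential + n * s)` except with
probability `exp (-s)`.

A leader has at most as many edges inside its component as the component has vertices, so the
potential is at most `n` plus twice the number of crossing edges (`potential_le`). Three rounds with
`m` about `k / 3` now reduce the number of crossing edges from at most `n ^ 2` to `O(n ^ 2 / k)`, to
`O(n)`, and to `O(n (1 + s) / k)` (`toOuterMeasure_pi_kOutSample_le`), which is at most `r` for `s = 2`
in the first part and `s = (α + 2) log n` in the second part. A sample without replacement of size
`k` is the result of `k` single draws (`kOutSample_bind_addOne`), so the rounds can be run one after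
the other.
-/

/-! ### Expectations and finite products of probability mass functions -/

namespace PMF

/-- The expectation of a nonnegative function. -/
noncomputable def expect {α : Type*} (p : PMF α) (f : α → ℝ≥0∞) : ℝ≥0∞ := ∑' a, p a * f a

theorem expect_bind {α β : Type*} (p : PMF α) (κ : α → PMF β) (f : β → ℝ≥0∞) :
    (p.bind κ).expect f = p.expect fun a => (κ a).expect f := by
  simp only [expect, bind_apply, ← ENNReal.tsum_mul_right, ← ENNReal.tsum_mul_left]
  rw [ENNReal.tsum_comm]
  simp only [mul_assoc]

theorem expect_pure {α : Type*} (a : α) (f : α → ℝ≥0∞) : (pure a).expect f = f a := by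
  rw [expect, tsum_eq_single a]
  · simp
  · intro b hb
    simp [hb]

theorem expect_map {α β : Type*} (p : PMF α) (g : α → β) (f : β → ℝ≥0∞) :
    (p.map g).expect f = p.expect (f ∘ g) := by
  rw [← bind_pure_comp, expect_bind]
  simp [expect_pure, Function.comp_def]

theorem expect_mono {α : Type*} (p : PMF α) {f g : α → ℝ≥0∞} (h : ∀ a ∈ p.support, f a ≤ g a) :
    p.expect f ≤ p.expect g := by
  refine ENNReal.tsum_le_tsum fun a => ?_
  by_cases ha : a ∈ p.support
  · gcongr
    exact h a ha
  · rw [← apply_eq_zero_iff] at ha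
    simp [ha]

theorem expect_const_mul {α : Type*} (p : PMF α) (c : ℝ≥0∞) (f : α → ℝ≥0∞) :
    p.expect (fun a => c * f a) = c * p.expect f := by
  simp only [expect, ← ENNReal.tsum_mul_left]
  congr 1 with a
  ring

theorem expect_add {α : Type*} (p : PMF α) (f g : α → ℝ≥0∞) :
    p.expect (fun a => f a + g a) = p.expect f + p.expect g := by
  simp only [expect, mul_add, ENNReal.tsum_add]

theorem expect_const {α : Type*} (p : PMF α) (c : ℝ≥0∞) : p.expect (fun _ => c) = c := by
  simp [expect, ENNReal.tsum_mul_right]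

theorem expect_indicator_one {α : Type*} (p : PMF α) (s : Set α) :
    p.expect (s.indicator 1) = p.toOuterMeasure s := by
  rw [toOuterMeasure_apply, expect]
  congr 1 with a
  by_cases ha : a ∈ s <;> simp [ha]

theorem toOuterMeasure_compl_add {α : Type*} (p : PMF α) (s : Set α) :
    p.toOuterMeasure s + p.toOuterMeasure sᶜ = 1 := by
  rw [← expect_indicator_one, ← expect_indicator_one, ← expect_add, ← expect_const p 1]
  congr 1 with a
  by_cases ha : a ∈ s <;> simp [ha]

variable {ι : Type*} [Fintype ι] [DecidableEq ι] {β γ : Type*} [Fintype β] [Fintype γ]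

/-- The law of a family of independent random variables with the laws `p i`. -/
noncomputable def pi (p : ι → PMF β) : PMF (ι → β) :=
  ofFintype (fun σ => ∏ i, p i (σ i)) <| by
    rw [← Fintype.piFinset_univ, ← Finset.prod_univ_sum]
    refine Finset.prod_eq_one fun i _ => ?_
    rw [← tsum_fintype (L := .unconditional _)]
    exact (p i).tsum_coe

theorem pi_apply (p : ι → PMF β) (σ : ι → β) : pi p σ = ∏ i, p i (σ i) := rfl

theorem mem_support_of_mem_support_pi {p : ι → PMF β} {σ : ι → β} (h : σ ∈ (pi p).support)
    (i : ι) : σ i ∈ (p i).support := by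
  rw [mem_support_iff, pi_apply] at h
  exact Finset.prod_ne_zero_iff.1 h i (Finset.mem_univ i)

theorem pi_pure (f : ι → β) : pi (fun i => pure (f i)) = pure f := by
  ext σ
  rw [pi_apply, pure_apply]
  by_cases h : σ = f
  · simp [h]
  · rw [if_neg h]
    obtain ⟨i, hi⟩ := Function.ne_iff.1 h
    exact Finset.prod_eq_zero (Finset.mem_univ i) (by simp [hi])

/-- Resampling one coordinate by a kernel that depends on this coordinate only preserves
independence. -/
theorem pi_bind_update (p : ι → PMF β) (i : ι) (κ : β → PMF β) :
    ((pi p).bind fun σ => (κ (σ i)).map (Function.update σ i)) =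
      pi (Function.update p i ((p i).bind κ)) := by
  classical
  ext τ
  have hmap : ∀ σ : ι → β, ((κ (σ i)).map (Function.update σ i)) τ =
      if σ = Function.update τ i (σ i) then κ (σ i) (τ i) else 0 := by
    intro σ
    rw [map_apply]
    split_ifs with h
    · rw [tsum_eq_single (τ i)]
      · rw [if_pos]
        rw [h]
        simp
      · intro y hy
        rw [if_neg]
        rintro rfl
        simp at hy
    · refine ENNReal.tsum_eq_zero.2 fun y => if_neg ?_
      rintro rfl
      simp at h
  have hprod : ∀ y : β, pi p (Function.update τ i y) =
      p i y * ∏ j ∈ Finset.univ.erase i, p j (τ j) := by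
    intro y
    rw [pi_apply, ← Finset.mul_prod_erase _ _ (Finset.mem_univ i)]
    congr 1
    · simp
    · refine Finset.prod_congr rfl fun j hj => ?_
      rw [Function.update_of_ne (Finset.ne_of_mem_erase hj)]
  have hinj : Function.Injective fun y : β => Function.update τ i y :=
    Function.update_injective τ i
  rw [bind_apply, pi_apply, ← Finset.mul_prod_erase _ _ (Finset.mem_univ i)]
  simp only [hmap, Function.update_self, bind_apply]
  have h1 : ∀ j ∈ Finset.univ.erase i,
      Function.update p i ((p i).bind κ) j (τ j) = p j (τ j) := by
    intro j hj
    rw [Function.update_of_ne (Finset.ne_of_mem_erase hj)]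
  rw [Finset.prod_congr rfl h1, ← ENNReal.tsum_mul_right, ← hinj.tsum_eq]
  · refine tsum_congr fun y => ?_
    simp only [Function.update_self, if_true, hprod]
    ring
  · intro σ hσ
    rw [Function.mem_support] at hσ
    refine ⟨σ i, ?_⟩
    by_contra h
    exact hσ (by rw [if_neg (Ne.symm h), mul_zero])

theorem pi_map (p : ι → PMF β) (f : ι → β → γ) :
    pi (fun i => (p i).map (f i)) = (pi p).map fun σ i => f i (σ i) := by
  classical
  ext τ
  simp only [pi_apply, map_apply, tsum_fintype, Finset.prod_univ_sum, Fintype.piFinset_univ]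
  refine Finset.sum_congr rfl fun σ _ => ?_
  split_ifs with h
  · simp [h]
  · obtain ⟨i, hi⟩ := Function.ne_iff.1 h
    exact Finset.prod_eq_zero (Finset.mem_univ i) (if_neg hi)

theorem measure_pi_toMeasure [MeasurableSpace β] [MeasurableSingletonClass β] (p : ι → PMF β) :
    MeasureTheory.Measure.pi (fun i => (p i).toMeasure) = (pi p).toMeasure := by
  refine MeasureTheory.Measure.ext_of_singleton fun σ => ?_
  rw [MeasureTheory.Measure.pi_singleton, toMeasure_apply_singleton _ _ (.singleton _), pi_apply]
  exact Finset.prod_congr rfl fun i _ => toMeasure_apply_singleton _ _ (.singleton _)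

end PMF

/-! ### Sampling edges one at a time -/

/-- Add to `S` a uniformly random element of `E \ S`, if there is one. -/
noncomputable def addOne {β : Type*} [DecidableEq β] (E S : Finset β) : PMF (Finset β) :=
  if h : (E \ S).Nonempty then (PMF.uniformOfFinset (E \ S) h).map (insert · S) else PMF.pure S

theorem addOne_apply_of_not {β : Type*} [DecidableEq β] {E S T : Finset β} (hS : S ⊆ E)
    (hlt : S.card < E.card) (hT : ¬ (T ⊆ E ∧ T.card = S.card + 1)) : addOne E S T = 0 := by
  have hne : (E \ S).Nonempty := by
    rw [← Finset.card_pos, Finset.card_sdiff_of_subset hS]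
    omega
  rw [addOne, dif_pos hne, PMF.apply_eq_zero_iff, PMF.mem_support_map_iff]
  rintro ⟨e, he, rfl⟩
  rw [PMF.mem_support_uniformOfFinset_iff, Finset.mem_sdiff] at he
  exact hT ⟨Finset.insert_subset he.1 hS, Finset.card_insert_of_notMem he.2⟩

theorem addOne_apply_of_card {β : Type*} [DecidableEq β] {E S T : Finset β} (hS : S ⊆ E)
    (hTE : T ⊆ E) (hT : T.card = S.card + 1) :
    addOne E S T = if S ⊆ T then ((E.card - S.card : ℕ) : ℝ≥0∞)⁻¹ else 0 := by
  have hlt : S.card < E.card := by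
    have := Finset.card_le_card hTE
    omega
  have hne : (E \ S).Nonempty := by
    rw [← Finset.card_pos, Finset.card_sdiff_of_subset hS]
    omega
  rw [addOne, dif_pos hne]
  split_ifs with h
  · have h1 : (T \ S).card = 1 := by rw [Finset.card_sdiff_of_subset h]; omega
    obtain ⟨e, he⟩ := Finset.card_eq_one.1 h1
    have heT : e ∈ T \ S := by simp [he]
    rw [Finset.mem_sdiff] at heT
    have hTe : T = insert e S := by
      rw [Finset.insert_eq, ← he, Finset.sdiff_union_of_subset h]
    rw [PMF.map_apply, tsum_eq_single e]
    · rw [if_pos hTe, PMF.uniformOfFinset_apply_of_mem, Finset.card_sdiff_of_subset hS]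
      exact Finset.mem_sdiff.2 ⟨hTE heT.1, heT.2⟩
    · intro f hf
      refine if_neg fun hTf => hf ?_
      have : e ∈ insert f S := hTf ▸ heT.1
      rcases Finset.mem_insert.1 this with h | h
      · exact h.symm
      · exact absurd h heT.2
  · rw [PMF.apply_eq_zero_iff, PMF.mem_support_map_iff]
    rintro ⟨e, he, rfl⟩
    exact h (Finset.subset_insert _ _)

theorem addOne_self {β : Type*} [DecidableEq β] (E : Finset β) : addOne E E = PMF.pure E := by
  simp [addOne]

theorem subset_of_mem_support_addOne {β : Type*} [DecidableEq β] {E S T : Finset β}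
    (h : T ∈ (addOne E S).support) : S ⊆ T := by
  rw [addOne] at h
  split_ifs at h with hne
  · obtain ⟨e, -, rfl⟩ := (PMF.mem_support_map_iff _ _ _).1 h
    exact Finset.subset_insert _ _
  · rw [PMF.mem_support_pure_iff] at h
    exact h.ge

theorem mem_support_kOutSample {b k : ℕ} {E S : Finset (Sym2 (VertexId b))} :
    S ∈ (kOutSample k E).support ↔ S ⊆ E ∧ S.card = min k E.card := by
  rw [kOutSample, PMF.mem_support_uniformOfFinset_iff, Finset.mem_powersetCard]

theorem kOutSample_of_card_le {b k : ℕ} {E : Finset (Sym2 (VertexId b))} (h : E.card ≤ k) :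
    kOutSample k E = PMF.pure E := by
  ext T
  rw [kOutSample, PMF.uniformOfFinset_apply, min_eq_right h, PMF.pure_apply,
    Finset.powersetCard_self]
  simp

theorem kOutSample_zero {b : ℕ} (E : Finset (Sym2 (VertexId b))) :
    kOutSample 0 E = PMF.pure ∅ := by
  ext T
  rw [kOutSample, PMF.uniformOfFinset_apply, PMF.pure_apply, Nat.zero_min,
    Finset.powersetCard_zero]
  simp

theorem kOutSample_apply {b k : ℕ} {E : Finset (Sym2 (VertexId b))} (hk : k ≤ E.card)
    (S : Finset (Sym2 (VertexId b))) :
    kOutSample k E S = if S ∈ E.powersetCard k then ((E.card.choose k : ℕ) : ℝ≥0∞)⁻¹ else 0 := by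
  rw [kOutSample, PMF.uniformOfFinset_apply, min_eq_left hk, Finset.card_powersetCard]
  congr

theorem kOutSample_bind_addOne {b k : ℕ} (E : Finset (Sym2 (VertexId b))) :
    (kOutSample k E).bind (addOne E) = kOutSample (k + 1) E := by
  rcases le_or_gt E.card k with h | h
  · rw [kOutSample_of_card_le h, kOutSample_of_card_le (h.trans k.le_succ), PMF.pure_bind,
      addOne_self]
  ext T
  have hsum : ((kOutSample k E).bind (addOne E)) T =
      ∑ S ∈ E.powersetCard k, ((E.card.choose k : ℕ) : ℝ≥0∞)⁻¹ * addOne E S T := by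
    rw [PMF.bind_apply, tsum_eq_sum (s := E.powersetCard k)]
    · refine Finset.sum_congr rfl fun S hS => ?_
      rw [kOutSample_apply h.le, if_pos hS]
    · intro S hS
      rw [kOutSample_apply h.le, if_neg hS, zero_mul]
  rw [hsum, kOutSample_apply h]
  split_ifs with hT
  · rw [Finset.mem_powersetCard] at hT
    have h1 : ∀ S ∈ E.powersetCard k, ((E.card.choose k : ℕ) : ℝ≥0∞)⁻¹ * addOne E S T =
        if S ⊆ T then ((E.card.choose k : ℕ) : ℝ≥0∞)⁻¹ * ((E.card - k : ℕ) : ℝ≥0∞)⁻¹ else 0 := by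
      intro S hS
      rw [Finset.mem_powersetCard] at hS
      rw [addOne_apply_of_card hS.1 hT.1 (by omega), hS.2]
      split_ifs <;> simp
    have h2 : (E.powersetCard k).filter (· ⊆ T) = T.powersetCard k := by
      ext S
      simp only [Finset.mem_filter, Finset.mem_powersetCard]
      exact ⟨fun h => ⟨h.2, h.1.2⟩, fun h => ⟨⟨h.1.trans hT.1, h.2⟩, h.1⟩⟩
    rw [Finset.sum_congr rfl h1, ← Finset.sum_filter, h2, Finset.sum_const,
      Finset.card_powersetCard, hT.2, Nat.choose_succ_self_right, nsmul_eq_mul,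
      ← ENNReal.mul_inv (by left; exact_mod_cast (Nat.choose_pos h.le).ne')
        (by left; exact ENNReal.natCast_ne_top _), ← Nat.cast_mul,
      ← Nat.choose_succ_right_eq, Nat.cast_mul,
      ENNReal.mul_inv (by right; exact ENNReal.natCast_ne_top _)
        (by left; exact ENNReal.natCast_ne_top _), mul_comm (_⁻¹), ← mul_assoc,
      ENNReal.mul_inv_cancel (by exact_mod_cast k.succ_ne_zero) (ENNReal.natCast_ne_top _),
      one_mul]
  · refine Finset.sum_eq_zero fun S hS => ?_
    rw [Finset.mem_powersetCard] at hS
    rw [addOne_apply_of_not hS.1 (by omega), mul_zero]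
    rw [Finset.mem_powersetCard] at hT
    rwa [hS.2]

/-! ### Crossing edges and the leader potential -/

section Potential

open Classical

variable {V : Type*} [Fintype V]

/-- The neighbours of `v` in `G` that lie outside the connected component of `v` in `H`. -/
noncomputable def crossNbrs (G H : SimpleGraph V) (v : V) : Finset V :=
  {u | G.Adj v u ∧ ¬ H.Reachable v u}

/-- The number of ordered pairs of `G`-adjacent vertices in different components of `H`, which is
twice the number of edges of `G` between the components of `H`. -/
noncomputable def crossing (G H : SimpleGraph V) : ℕ := ∑ v, (crossNbrs G H v).card

/-- The crossing edges at `v` that lead to a vertex with a larger key. -/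
noncomputable def upCross (G H : SimpleGraph V) (key : V → ℕ) (v : V) : Finset V :=
  {u ∈ crossNbrs G H v | key v < key u}

/-- `v` has the largest key in its connected component. -/
def IsLeader (H : SimpleGraph V) (key : V → ℕ) (v : V) : Prop :=
  ∀ u, H.Reachable v u → key u ≤ key v

/-- The number of neighbours of `v`. -/
noncomputable def deg (G : SimpleGraph V) (v : V) : ℕ := ({u | G.Adj v u} : Finset V).card

/-- The sum of the `G`-degrees of the leaders of the connected components of `H`. -/
noncomputable def potential (G H : SimpleGraph V) (key : V → ℕ) : ℕ :=
  ∑ v with IsLeader H key v, deg G v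

/-- An injective numbering of the vertices that refines the order by degree. -/
structure IsDegreeKey (G : SimpleGraph V) (key : V → ℕ) : Prop where
  injective : Function.Injective key
  deg_le : ∀ u v, key u ≤ key v → deg G u ≤ deg G v

theorem exists_isDegreeKey (G : SimpleGraph V) : ∃ key, IsDegreeKey G key := by
  let e := Fintype.equivFin V
  have hlt : ∀ u v, deg G u < deg G v →
      deg G u * Fintype.card V + e u < deg G v * Fintype.card V + e v := by
    intro u v h
    have h1 := (e u).isLt
    nlinarith
  refine ⟨fun v => deg G v * Fintype.card V + e v, fun u v h => ?_, fun u v h => ?_⟩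
  · rcases lt_trichotomy (deg G u) (deg G v) with h1 | h1 | h1
    · exact absurd h (hlt _ _ h1).ne
    · simp only [h1, add_right_inj] at h
      exact e.injective (Fin.ext h)
    · exact absurd h (hlt _ _ h1).ne'
  · by_contra! h1
    exact absurd h (hlt _ _ h1).not_ge

variable {G H H' : SimpleGraph V} {key : V → ℕ}

theorem mem_crossNbrs {v u : V} : u ∈ crossNbrs G H v ↔ G.Adj v u ∧ ¬ H.Reachable v u := by
  simp [crossNbrs]

theorem mem_upCross {v u : V} :
    u ∈ upCross G H key v ↔ G.Adj v u ∧ ¬ H.Reachable v u ∧ key v < key u := by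
  simp [upCross, mem_crossNbrs, and_assoc]

theorem upCross_anti (h : H ≤ H') (v : V) : upCross G H' key v ⊆ upCross G H key v := by
  intro u hu
  rw [mem_upCross] at hu ⊢
  exact ⟨hu.1, fun hr => hu.2.1 (hr.mono h), hu.2.2⟩

theorem deg_le_card (G : SimpleGraph V) (v : V) : deg G v ≤ Fintype.card V :=
  Finset.card_le_univ _

theorem crossing_le_sq (G H : SimpleGraph V) : crossing G H ≤ Fintype.card V ^ 2 := by
  calc crossing G H ≤ ∑ _v : V, Fintype.card V := Finset.sum_le_sum fun v _ => Finset.card_le_univ _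
    _ = Fintype.card V ^ 2 := by simp [sq]

theorem crossing_le_two_mul_sum_upCross (hkey : Function.Injective key) :
    crossing G H ≤ 2 * ∑ v, (upCross G H key v).card := by
  have h1 : ∀ v, (crossNbrs G H v).card =
      (upCross G H key v).card + ({u ∈ crossNbrs G H v | key u < key v}).card := by
    intro v
    rw [← Finset.card_filter_add_card_filter_not (s := crossNbrs G H v) (fun u => key v < key u)]
    congr 2
    refine Finset.filter_congr fun u hu => ?_
    have hne : key u ≠ key v := fun h => (mem_crossNbrs.1 hu).1.ne (hkey h).symm
    omega
  have h2 : ∑ v, ({u ∈ crossNbrs G H v | key u < key v}).card =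
      ∑ v, (upCross G H key v).card := by
    simp only [upCross, crossNbrs, Finset.filter_filter, Finset.card_filter]
    rw [Finset.sum_comm]
    refine Finset.sum_congr rfl fun u _ => Finset.sum_congr rfl fun v _ => ?_
    simp only [G.adj_comm v u, SimpleGraph.reachable_comm (u := v) (v := u)]
  rw [crossing, Finset.sum_congr rfl fun v _ => h1 v, Finset.sum_add_distrib, h2, two_mul]

theorem IsLeader.anti {V : Type*} {H H' : SimpleGraph V} {key : V → ℕ} (h : H ≤ H') {v : V}
    (hv : IsLeader H' key v) : IsLeader H key v :=
  fun u hu => hv u (hu.mono h)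

theorem exists_isLeader (H : SimpleGraph V) (key : V → ℕ) (v : V) :
    ∃ s, H.Reachable v s ∧ IsLeader H key s := by
  obtain ⟨s, hs, hmax⟩ := Finset.exists_max_image ({u | H.Reachable v u} : Finset V) key
    ⟨v, by simp⟩
  rw [Finset.mem_filter_univ] at hs
  exact ⟨s, hs, fun u hu => hmax u (by simpa using hs.trans hu)⟩

/-- A leader has at most as many neighbours inside its component as the component has vertices;
its other edges are crossing. -/
theorem potential_le (hkey : Function.Injective key) :
    potential G H key ≤ Fintype.card V + crossing G H := by
  have hdeg : ∀ v, deg G v ≤ ({u | H.Reachable v u} : Finset V).card + (crossNbrs G H v).card := by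
    intro v
    rw [deg, ← Finset.card_filter_add_card_filter_not (fun u => H.Reachable v u)]
    refine add_le_add (Finset.card_le_card fun u => ?_) (Finset.card_le_card fun u => ?_)
    · simp
    · simp [mem_crossNbrs]
  have hreach : ∑ v with IsLeader H key v, ({u | H.Reachable v u} : Finset V).card ≤
      Fintype.card V := by
    simp only [Finset.card_filter]
    rw [Finset.sum_comm, ← Finset.card_univ, Finset.card_eq_sum_ones]
    refine Finset.sum_le_sum fun u _ => ?_
    rw [← Finset.card_filter, Finset.card_le_one]
    intro s hs t ht
    simp only [Finset.mem_filter, Finset.mem_univ, true_and] at hs ht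
    have hst : H.Reachable s t := hs.2.trans ht.2.symm
    exact hkey (le_antisymm (ht.1 s hst.symm) (hs.1 t hst))
  calc potential G H key
      ≤ ∑ v with IsLeader H key v,
          (({u | H.Reachable v u} : Finset V).card + (crossNbrs G H v).card) :=
        Finset.sum_le_sum fun v _ => hdeg v
    _ ≤ _ := by
        rw [Finset.sum_add_distrib]
        exact add_le_add hreach (Finset.sum_le_sum_of_subset (Finset.filter_subset _ _))

theorem potential_anti (h : H ≤ H') : potential G H' key ≤ potential G H key :=
  Finset.sum_le_sum_of_subset fun v hv => by
    rw [Finset.mem_filter_univ] at hv ⊢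
    exact hv.anti h

theorem potential_add_deg_le_of_lost (h : H ≤ H') {s : V} (hs : IsLeader H key s)
    (hs' : ¬ IsLeader H' key s) : potential G H' key + deg G s ≤ potential G H key := by
  have hsub : insert s ({v | IsLeader H' key v} : Finset V) ⊆ ({v | IsLeader H key v} : Finset V) := by
    refine Finset.insert_subset (by simpa using hs) fun v hv => ?_
    rw [Finset.mem_filter_univ] at hv ⊢
    exact hv.anti h
  calc potential G H' key + deg G s
      = ∑ v ∈ insert s ({v | IsLeader H' key v} : Finset V), deg G v := by
        rw [Finset.sum_insert (by simpa using hs'), add_comm, potential]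
    _ ≤ _ := Finset.sum_le_sum_of_subset hsub

/-- When an edge `vu` with `deg v ≤ deg u` merges two components, one of the two leaders is lost,
and its degree is at least that of `v`. -/
theorem potential_add_deg_le (hkey : IsDegreeKey G key) (h : H ≤ H') {v u : V}
    (hu : u ∈ upCross G H key v) (hadj : H'.Adj v u) :
    potential G H' key + deg G v ≤ potential G H key := by
  rw [mem_upCross] at hu
  obtain ⟨s, hvs, hs⟩ := exists_isLeader H key v
  obtain ⟨t, hut, ht⟩ := exists_isLeader H key u
  have hst : H'.Reachable s t :=
    (hvs.mono h).symm.trans (hadj.reachable.trans (hut.mono h))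
  rcases lt_trichotomy (key s) (key t) with hlt | heq | hlt
  · have h1 := potential_add_deg_le_of_lost (G := G) h hs fun hs' => (hs' t hst).not_gt hlt
    have h2 := hkey.deg_le v s (hs v hvs.symm)
    omega
  · rw [hkey.injective heq] at hvs
    exact absurd (hvs.trans hut.symm) hu.2.1
  · have h1 := potential_add_deg_le_of_lost (G := G) h ht fun ht' => (ht' s hst.symm).not_gt hlt
    have h2 := hkey.deg_le v t (hu.2.2.le.trans (ht u hut.symm))
    omega

end Potential

/-! ### The sampling process -/

section Sampling

variable {b : ℕ} {V : Finset (VertexId b)}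

/-- The graph whose edges are the sampled ones; `σ v` is the sample of the vertex `v`. -/
def sampledGraph (σ : V → Finset (Sym2 (VertexId b))) : SimpleGraph V where
  Adj u w := u ≠ w ∧ ∃ v, s(u.1, w.1) ∈ σ v
  symm := ⟨fun _ _ h => ⟨h.1.symm, h.2.imp fun _ hv => Sym2.eq_swap ▸ hv⟩⟩
  loopless := ⟨fun _ h => h.1 rfl⟩

theorem sampledGraph_mono {σ τ : V → Finset (Sym2 (VertexId b))} (h : σ ≤ τ) :
    sampledGraph σ ≤ sampledGraph τ :=
  fun _ _ huw => ⟨huw.1, huw.2.imp fun v hv => h v hv⟩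

/-- The edges of `G` at the vertex `v`. -/
noncomputable abbrev edgesAt (G : SimpleGraph V) (v : V) : Finset (Sym2 (VertexId b)) :=
  incidentEdges v (neighborIds G v)

variable {G : SimpleGraph V}

theorem mem_neighborIds {v : V} {i : VertexId b} :
    i ∈ neighborIds G v ↔ ∃ u : V, G.Adj v u ∧ u.1 = i := by
  simp [neighborIds]

theorem mem_edgesAt {v : V} {e : Sym2 (VertexId b)} :
    e ∈ edgesAt G v ↔ ∃ u : V, G.Adj v u ∧ s(v.1, u.1) = e := by
  simp only [edgesAt, incidentEdges, Finset.mem_image, mem_neighborIds]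
  constructor
  · rintro ⟨_, ⟨u, hu, rfl⟩, rfl⟩
    exact ⟨u, hu, rfl⟩
  · rintro ⟨u, hu, rfl⟩
    exact ⟨_, ⟨u, hu, rfl⟩, rfl⟩

theorem edge_injective (v : V) : Function.Injective fun u : V => s(v.1, u.1) := by
  intro u w h
  exact Subtype.ext (Sym2.congr_right.1 h)

theorem edgesAt_eq_image (v : V) :
    edgesAt G v = (by classical exact
      ({u | G.Adj v u} : Finset V).image fun u : V => s(v.1, u.1)) := by
  ext e
  simp [mem_edgesAt]

theorem card_edgesAt (v : V) : (edgesAt G v).card = deg G v := by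
  rw [edgesAt_eq_image, deg, Finset.card_image_of_injective _ (edge_injective v)]

/-- One step of the process: the vertex `v` samples one more of its edges. -/
noncomputable def sampleStep (G : SimpleGraph V) (v : V) (σ : V → Finset (Sym2 (VertexId b))) :
    PMF (V → Finset (Sym2 (VertexId b))) :=
  (addOne (edgesAt G v) (σ v)).map (Function.update σ v)

/-- The process in which the vertices in the list `l` sample one more edge each, in this order. -/
noncomputable def sampleRun (G : SimpleGraph V) :
    List V → (V → Finset (Sym2 (VertexId b))) → PMF (V → Finset (Sym2 (VertexId b)))
  | [], σ => PMF.pure σ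
  | v :: l, σ => (sampleStep G v σ).bind (sampleRun G l)

theorem le_of_mem_support_sampleStep {v : V} {σ τ : V → Finset (Sym2 (VertexId b))}
    (h : τ ∈ (sampleStep G v σ).support) : σ ≤ τ := by
  obtain ⟨S, hS, rfl⟩ := (PMF.mem_support_map_iff _ _ _).1 h
  rw [le_update_iff]
  exact ⟨subset_of_mem_support_addOne hS, fun _ _ => le_rfl⟩

theorem le_of_mem_support_sampleRun {l : List V} {σ τ : V → Finset (Sym2 (VertexId b))}
    (h : τ ∈ (sampleRun G l σ).support) : σ ≤ τ := by
  induction l generalizing σ with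
  | nil =>
    rw [sampleRun, PMF.mem_support_pure_iff] at h
    exact h.ge
  | cons v l ih =>
    obtain ⟨ρ, hρ, hτ⟩ := (PMF.mem_support_bind_iff _ _ _).1 h
    exact (le_of_mem_support_sampleStep hρ).trans (ih hτ)

theorem pi_kOutSample_bind_sampleRun (l : List V) (c : V → ℕ) :
    (PMF.pi fun v => kOutSample (c v) (edgesAt G v)).bind (sampleRun G l) =
      PMF.pi fun v => kOutSample (c v + l.count v) (edgesAt G v) := by
  induction l generalizing c with
  | nil =>
    have : sampleRun G [] = PMF.pure := rfl
    simp [this]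
  | cons w l ih =>
    have hstep : (PMF.pi fun v => kOutSample (c v) (edgesAt G v)).bind (sampleStep G w) =
        PMF.pi fun v => kOutSample (Function.update c w (c w + 1) v) (edgesAt G v) := by
      unfold sampleStep
      rw [PMF.pi_bind_update _ w (addOne (edgesAt G w)), kOutSample_bind_addOne]
      congr 1
      ext1 v
      by_cases h : v = w
      · subst h
        simp
      · simp [h]
    have hrun : sampleRun G (w :: l) = fun σ => (sampleStep G w σ).bind (sampleRun G l) := rfl
    rw [hrun, ← PMF.bind_bind, hstep, ih]
    congr 1
    ext1 v
    congr 1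
    by_cases h : v = w
    · subst h
      simp
      ring
    · simp [h, List.count_cons_of_ne (Ne.symm h)]

end Sampling

/-! ### Concentration along the sampling process -/

namespace PMF

theorem expect_uniformOfFinset {α : Type*} (s : Finset α) (hs : s.Nonempty) (f : α → ℝ)
    (hf : ∀ a, 0 ≤ f a) :
    (uniformOfFinset s hs).expect (fun a => ENNReal.ofReal (f a)) =
      ENNReal.ofReal ((∑ a ∈ s, f a) / s.card) := by
  rw [expect, tsum_eq_sum (s := s) (fun a ha => by
    rw [uniformOfFinset_apply_of_notMem hs ha, zero_mul]), div_eq_inv_mul,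
    ENNReal.ofReal_mul (by positivity), ENNReal.ofReal_sum_of_nonneg fun a _ => hf a,
    Finset.mul_sum]
  refine Finset.sum_congr rfl fun a ha => ?_
  rw [uniformOfFinset_apply_of_mem hs ha, ENNReal.ofReal_inv_of_pos (by
    exact_mod_cast hs.card_pos), ENNReal.ofReal_natCast]

end PMF

theorem Real.exp_neg_le_one_sub_half {x : ℝ} (h0 : 0 ≤ x) (h1 : x ≤ 1) :
    Real.exp (-x) ≤ 1 - x / 2 := by
  have h2 : Real.exp (-x) * (1 + x) ≤ 1 := by
    calc Real.exp (-x) * (1 + x) ≤ Real.exp (-x) * Real.exp x := by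
          gcongr
          linarith [Real.add_one_le_exp x]
      _ = 1 := by rw [← Real.exp_add]; simp
  have h3 : 0 < Real.exp (-x) := Real.exp_pos _
  nlinarith

theorem List.sum_map_eq_sum_count_mul {α : Type*} [Fintype α] [BEq α] [LawfulBEq α] (l : List α)
    (f : α → ℝ) : (l.map f).sum = ∑ a, (l.count a : ℝ) * f a := by
  classical
  induction l with
  | nil => simp
  | cons a l ih =>
    simp [ih, List.count_cons, add_mul, Finset.sum_add_distrib, ite_mul, add_comm]

section Concentration

variable {b : ℕ} {V : Finset (VertexId b)} {G : SimpleGraph V} {key : V → ℕ}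

/-- Each of the at most `deg v` unsampled edges at `v` is drawn with probability at least
`1 / deg v`, and each edge to a vertex of `upCross` lowers the potential by at least `deg v`. -/
theorem expect_sampleStep_le (hkey : IsDegreeKey G key) (v : V)
    (σ : V → Finset (Sym2 (VertexId b))) :
    (sampleStep G v σ).expect (fun τ => ENNReal.ofReal (Real.exp
      (((potential G (sampledGraph τ) key : ℝ) - potential G (sampledGraph σ) key) /
        Fintype.card V))) ≤
      ENNReal.ofReal (Real.exp
        (-((upCross G (sampledGraph σ) key v).card / (2 * Fintype.card V)))) := by
  classical
  have hn : (0 : ℝ) < Fintype.card V := by exact_mod_cast Fintype.card_pos_iff.2 ⟨v⟩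
  have hmem : ∀ u ∈ upCross G (sampledGraph σ) key v, s(v.1, u.1) ∈ edgesAt G v \ σ v := by
    intro u hu
    rw [mem_upCross] at hu
    rw [Finset.mem_sdiff, mem_edgesAt]
    refine ⟨⟨u, hu.1, rfl⟩, fun h => hu.2.1 ?_⟩
    exact SimpleGraph.Adj.reachable ⟨hu.1.ne, v, h⟩
  have hle : ∀ S, σ v ⊆ S → sampledGraph σ ≤ sampledGraph (Function.update σ v S) := fun S hS =>
    sampledGraph_mono (le_update_iff.2 ⟨hS, fun _ _ => le_rfl⟩)
  rw [sampleStep, PMF.expect_map, addOne]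
  split_ifs with hne
  · rw [PMF.expect_map]
    set g : Sym2 (VertexId b) → ℝ := fun e => Real.exp
      (((potential G (sampledGraph (Function.update σ v (insert e (σ v)))) key : ℝ) -
        potential G (sampledGraph σ) key) / Fintype.card V) with hg
    change (PMF.uniformOfFinset (edgesAt G v \ σ v) hne).expect (fun e => ENNReal.ofReal (g e)) ≤ _
    rw [PMF.expect_uniformOfFinset _ _ _ fun e => (Real.exp_pos _).le]
    refine ENNReal.ofReal_le_ofReal ?_
    set F := edgesAt G v \ σ v with hF
    set U := (upCross G (sampledGraph σ) key v).image fun u : V => s(v.1, u.1) with hU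
    have hUcard : U.card = (upCross G (sampledGraph σ) key v).card :=
      Finset.card_image_of_injective _ (edge_injective v)
    have hUF : U ⊆ F := by
      intro e he
      obtain ⟨u, hu, rfl⟩ := Finset.mem_image.1 he
      exact hmem u hu
    have hFpos : (0 : ℝ) < F.card := by exact_mod_cast hne.card_pos
    have hFdeg : (F.card : ℝ) ≤ deg G v := by
      rw [← card_edgesAt]
      exact_mod_cast Finset.card_le_card Finset.sdiff_subset
    have hdn : (deg G v : ℝ) / Fintype.card V ≤ 1 := by
      rw [div_le_one hn]
      exact_mod_cast deg_le_card G v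
    have hg1 : ∀ e ∈ F, g e ≤ 1 := by
      intro e _
      rw [hg, Real.exp_le_one_iff]
      refine div_nonpos_of_nonpos_of_nonneg (sub_nonpos.2 ?_) hn.le
      exact_mod_cast potential_anti (hle _ (Finset.subset_insert _ _))
    have hg2 : ∀ e ∈ U, g e ≤ 1 - deg G v / (2 * Fintype.card V) := by
      intro e he
      obtain ⟨u, hu, rfl⟩ := Finset.mem_image.1 he
      have hadj : (sampledGraph (Function.update σ v (insert s(v.1, u.1) (σ v)))).Adj v u :=
        ⟨(mem_upCross.1 hu).1.ne, v, by simp⟩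
      have hpot := potential_add_deg_le hkey (hle _ (Finset.subset_insert _ _)) hu hadj
      have hpot' : (potential G (sampledGraph
          (Function.update σ v (insert s(v.1, u.1) (σ v)))) key : ℝ) + deg G v ≤
          potential G (sampledGraph σ) key := by exact_mod_cast hpot
      calc g s(v.1, u.1) ≤ Real.exp (-((deg G v : ℝ) / Fintype.card V)) := by
            rw [hg]
            refine Real.exp_le_exp.2 ?_
            rw [← neg_div]
            gcongr
            linarith
        _ ≤ 1 - (deg G v : ℝ) / Fintype.card V / 2 :=
            Real.exp_neg_le_one_sub_half (by positivity) hdn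
        _ = _ := by rw [div_div, mul_comm (Fintype.card V : ℝ)]
    have hsum : ∑ e ∈ F, g e ≤ F.card - U.card * (deg G v / (2 * Fintype.card V)) := by
      calc ∑ e ∈ F, g e
          ≤ ∑ e ∈ F, (1 - if e ∈ U then (deg G v : ℝ) / (2 * Fintype.card V) else 0) := by
            refine Finset.sum_le_sum fun e he => ?_
            split_ifs with h
            · exact hg2 e h
            · simpa using hg1 e he
        _ = _ := by
            rw [Finset.sum_sub_distrib, Finset.sum_ite_mem, Finset.inter_eq_right.2 hUF]
            simp
    calc (∑ e ∈ F, g e) / F.card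
        ≤ (F.card - U.card * (deg G v / (2 * Fintype.card V))) / F.card := by gcongr
      _ = 1 - U.card / (2 * Fintype.card V) * (deg G v / F.card) := by
          field_simp
      _ ≤ 1 - U.card / (2 * Fintype.card V) * 1 := by
          gcongr
          rwa [one_le_div hFpos]
      _ ≤ Real.exp (-((upCross G (sampledGraph σ) key v).card / (2 * Fintype.card V))) := by
          rw [← hUcard]
          linarith [Real.add_one_le_exp (-((U.card : ℝ) / (2 * Fintype.card V)))]
  · have hempty : upCross G (sampledGraph σ) key v = ∅ := by
      rw [Finset.eq_empty_iff_forall_notMem]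
      exact fun u hu => hne ⟨_, hmem u hu⟩
    rw [PMF.expect_pure, hempty]
    simp

/-- The expectation bound for the exponential supermartingale of the process, with the number of crossing edges at each step
replaced by the number in the end. -/
theorem expect_sampleRun_le_one (hkey : IsDegreeKey G key) (l : List V)
    (σ : V → Finset (Sym2 (VertexId b))) :
    (sampleRun G l σ).expect (fun τ => ENNReal.ofReal (Real.exp
      ((l.map fun v => ((upCross G (sampledGraph τ) key v).card : ℝ)).sum /
          (2 * Fintype.card V) +
        ((potential G (sampledGraph τ) key : ℝ) - potential G (sampledGraph σ) key) /
          Fintype.card V))) ≤ 1 := by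
  induction l generalizing σ with
  | nil => simp [sampleRun, PMF.expect_pure]
  | cons v l ih =>
    set c : ℝ := (upCross G (sampledGraph σ) key v).card / (2 * Fintype.card V) with hc
    rw [sampleRun, PMF.expect_bind]
    have hstep : ∀ ρ ∈ (sampleStep G v σ).support,
        ((sampleRun G l ρ).expect fun τ => ENNReal.ofReal (Real.exp
          (((v :: l).map fun v => ((upCross G (sampledGraph τ) key v).card : ℝ)).sum /
              (2 * Fintype.card V) +
            ((potential G (sampledGraph τ) key : ℝ) - potential G (sampledGraph σ) key) /
              Fintype.card V))) ≤
        ENNReal.ofReal (Real.exp c) * ENNReal.ofReal (Real.exp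
          (((potential G (sampledGraph ρ) key : ℝ) - potential G (sampledGraph σ) key) /
            Fintype.card V)) := by
      intro ρ hρ
      rw [← ENNReal.ofReal_mul (Real.exp_pos _).le, ← Real.exp_add]
      refine le_trans ?_ (mul_le_of_le_one_right' (ih ρ))
      rw [← PMF.expect_const_mul]
      refine PMF.expect_mono _ fun τ hτ => ?_
      rw [← ENNReal.ofReal_mul (Real.exp_pos _).le, ← Real.exp_add]
      refine ENNReal.ofReal_le_ofReal (Real.exp_le_exp.2 ?_)
      have hle : σ ≤ τ :=
        (le_of_mem_support_sampleStep hρ).trans (le_of_mem_support_sampleRun hτ)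
      have hcard : ((upCross G (sampledGraph τ) key v).card : ℝ) / (2 * Fintype.card V) ≤ c := by
        rw [hc]
        gcongr
        exact upCross_anti (sampledGraph_mono hle) v
      rw [List.map_cons, List.sum_cons, add_div]
      simp only [sub_div]
      linarith
    refine (PMF.expect_mono _ hstep).trans ?_
    rw [PMF.expect_const_mul]
    refine (mul_le_mul_right (expect_sampleStep_le hkey v σ) _).trans ?_
    rw [← ENNReal.ofReal_mul (Real.exp_pos _).le, ← Real.exp_add, hc]
    simp

/-- If every vertex samples at least `m` edges, then up to probability `exp (-s)` the number of
crossing edges drops to at most `4 (n + crossing + n s) / m`. -/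
theorem toOuterMeasure_sampleRun_le (hV : 0 < Fintype.card V) {l : List V} {m : ℕ}
    (hl : ∀ v, m ≤ l.count v) (σ : V → Finset (Sym2 (VertexId b))) (s : ℝ) :
    (sampleRun G l σ).toOuterMeasure {τ | 4 * (Fintype.card V : ℝ) * (1 + s) +
      4 * crossing G (sampledGraph σ) < m * crossing G (sampledGraph τ)} ≤
      ENNReal.ofReal (Real.exp (-s)) := by
  obtain ⟨key, hkey⟩ := exists_isDegreeKey G
  have hn : (0 : ℝ) < Fintype.card V := by exact_mod_cast hV
  rw [← PMF.expect_indicator_one]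
  refine le_trans ?_ (mul_le_of_le_one_right' (expect_sampleRun_le_one hkey l σ))
  rw [← PMF.expect_const_mul]
  refine PMF.expect_mono _ fun τ _ => ?_
  refine Set.indicator_apply_le' (fun hτ => ?_) (fun _ => zero_le)
  rw [Set.mem_ofPred_eq] at hτ
  rw [← ENNReal.ofReal_mul (Real.exp_pos _).le, ← Real.exp_add, Pi.one_apply,
    ENNReal.one_le_ofReal, Real.one_le_exp_iff]
  have hcount : (m * crossing G (sampledGraph τ) : ℝ) ≤
      2 * (l.map fun v => ((upCross G (sampledGraph τ) key v).card : ℝ)).sum := by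
    have h2 : (crossing G (sampledGraph τ) : ℝ) ≤
        2 * ∑ v, ((upCross G (sampledGraph τ) key v).card : ℝ) := by
      exact_mod_cast crossing_le_two_mul_sum_upCross hkey.injective
    calc (m * crossing G (sampledGraph τ) : ℝ)
        ≤ m * (2 * ∑ v, ((upCross G (sampledGraph τ) key v).card : ℝ)) := by gcongr
      _ = 2 * ∑ v, (m : ℝ) * (upCross G (sampledGraph τ) key v).card := by
          rw [Finset.mul_sum, Finset.mul_sum, Finset.mul_sum]
          exact Finset.sum_congr rfl fun v _ => by ring
      _ ≤ _ := by
          rw [List.sum_map_eq_sum_count_mul]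
          gcongr with v _
          exact hl v
  have hpot : (potential G (sampledGraph σ) key : ℝ) ≤
      Fintype.card V + crossing G (sampledGraph σ) := by
    exact_mod_cast potential_le hkey.injective
  have hpos : (0 : ℝ) ≤ potential G (sampledGraph τ) key := Nat.cast_nonneg _
  generalize (l.map fun v => ((upCross G (sampledGraph τ) key v).card : ℝ)).sum = X at *
  have : -s + (X / (2 * Fintype.card V) +
      ((potential G (sampledGraph τ) key : ℝ) - potential G (sampledGraph σ) key) /
        Fintype.card V) =
      (X + 2 * (potential G (sampledGraph τ) key - potential G (sampledGraph σ) key) -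
        2 * Fintype.card V * s) / (2 * Fintype.card V) := by
    field_simp
    ring
  rw [this]
  refine div_nonneg ?_ (by positivity)
  linarith

/-- Three rounds of sampling in a row: the first one leaves `O(n² / k)` crossing edges, the second
one `O(n² / k² + n / k)`, the third one `O(n / k)` as soon as `n² / k² = O(n)`. -/
theorem toOuterMeasure_pi_kOutSample_le (hV : 0 < Fintype.card V) {k m : ℕ} (hm : 0 < m)
    (hmk : 3 * m ≤ k) {s : ℝ} {R : ℝ}
    (hR : 4 * Fintype.card V * (1 + s) / m + 4 * (4 * Fintype.card V * (1 + s)) / m ^ 2 +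
      16 * (4 * Fintype.card V * (1 + s)) / m ^ 3 + 64 * Fintype.card V ^ 2 / m ^ 3 ≤ R) :
    (PMF.pi fun v => kOutSample k (edgesAt G v)).toOuterMeasure
      {τ | R < crossing G (sampledGraph τ)} ≤ 3 * ENNReal.ofReal (Real.exp (-s)) := by
  classical
  set n : ℝ := (Fintype.card V : ℝ) with hn
  set B : ℝ := 4 * n * (1 + s) with hB
  have hm0 : (0 : ℝ) < m := by exact_mod_cast hm
  -- In a round, the vertices make `j` draws each.
  let rounds : ℕ → List V := fun j => (Finset.univ : Finset V).toList.flatMap (List.replicate j)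
  have hrounds : ∀ j v, (rounds j).count v = j := by
    intro j v
    simp only [rounds, List.count_flatMap, Function.comp_def, List.count_replicate]
    rw [Finset.sum_map_toList]
    simp
  let ε : ℝ≥0∞ := ENNReal.ofReal (Real.exp (-s))
  have hstage : ∀ j, m ≤ j → ∀ (σ : V → Finset (Sym2 (VertexId b))) (y : ℝ),
      (crossing G (sampledGraph σ) : ℝ) ≤ y →
      (sampleRun G (rounds j) σ).toOuterMeasure
        {τ | (B + 4 * y) / m < crossing G (sampledGraph τ)} ≤ ε := by
    intro j hj σ y hy
    refine le_trans (MeasureTheory.measure_mono fun τ hτ => ?_)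
      (toOuterMeasure_sampleRun_le (m := m) hV (fun v => by rw [hrounds]; exact hj) σ s)
    rw [Set.mem_ofPred_eq, div_lt_iff₀ hm0] at hτ
    rw [Set.mem_ofPred_eq]
    linarith
  have hbind : ∀ (p : PMF (V → Finset (Sym2 (VertexId b)))) (j : ℕ) (y : ℝ) (δ : ℝ≥0∞), m ≤ j →
      p.toOuterMeasure {τ | y < crossing G (sampledGraph τ)} ≤ δ →
      (p.bind (sampleRun G (rounds j))).toOuterMeasure
        {τ | (B + 4 * y) / m < crossing G (sampledGraph τ)} ≤ δ + ε := by
    intro p j y δ hj hp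
    rw [← PMF.expect_indicator_one, PMF.expect_bind]
    refine le_trans (PMF.expect_mono p (g := fun σ =>
      Set.indicator {τ | y < crossing G (sampledGraph τ)} 1 σ + ε) fun σ _ => ?_) ?_
    · rw [PMF.expect_indicator_one]
      by_cases h : y < crossing G (sampledGraph σ)
      · rw [Set.indicator_of_mem (by exact h), Pi.one_apply]
        exact le_add_right ((PMF.toOuterMeasure _).mono (Set.subset_univ _) |>.trans_eq
          ((PMF.toOuterMeasure_apply_eq_one_iff _ _).2 (Set.subset_univ _)))
      · exact le_add_left (hstage j hj σ y (not_lt.1 h))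
    · rw [PMF.expect_add, PMF.expect_indicator_one, PMF.expect_const]
      gcongr
  -- The last round uses all the `k - 2 * m ≥ m` draws that remain.
  have hlaw : (PMF.pi fun v => kOutSample k (edgesAt G v)) =
      (((PMF.pure fun _ => ∅).bind (sampleRun G (rounds m))).bind (sampleRun G (rounds m))).bind
        (sampleRun G (rounds (k - 2 * m))) := by
    have hstart : (fun _ : V => (PMF.pure ∅ : PMF (Finset (Sym2 (VertexId b))))) =
        fun v => kOutSample 0 (edgesAt G v) := funext fun v => (kOutSample_zero _).symm
    rw [← PMF.pi_pure, hstart]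
    rw [pi_kOutSample_bind_sampleRun, pi_kOutSample_bind_sampleRun, pi_kOutSample_bind_sampleRun]
    simp only [hrounds]
    congr 2
    ext1 v
    congr 1
    omega
  have h0 : (PMF.pure (fun _ => ∅) : PMF (V → Finset (Sym2 (VertexId b)))).toOuterMeasure
      {τ | n ^ 2 < crossing G (sampledGraph τ)} ≤ 0 := by
    rw [nonpos_iff_eq_zero, PMF.toOuterMeasure_apply_eq_zero_iff, Set.disjoint_left]
    intro τ _ h
    rw [Set.mem_ofPred_eq] at h
    refine not_le.2 h ?_
    rw [hn]
    exact_mod_cast crossing_le_sq _ _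
  have h3 := hbind _ (k - 2 * m) _ _ (by omega) (hbind _ m _ _ le_rfl (hbind _ m _ _ le_rfl h0))
  rw [hlaw]
  refine le_trans (MeasureTheory.measure_mono fun τ hτ => ?_) (h3.trans_eq (by ring))
  rw [Set.mem_ofPred_eq] at hτ ⊢
  refine lt_of_le_of_lt (le_of_eq ?_) (hR.trans_lt hτ)
  field_simp
  ring

end Concentration

/-! ### Resilient edge names and encodings -/

/-- Names from a Vandermonde matrix: the name of `e` lists the powers `φ e ^ i`, `i < 2 * r`, for an
injection `φ` into a field of characteristic two. A vanishing sum over a nonempty set `D` of at most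
`2 * r` edges would make `∑ e ∈ D, p (φ e)` vanish for all polynomials `p` of degree less than
`2 * r`, which fails for a polynomial vanishing on all but one element of `φ '' D`. -/
theorem exists_isResilient (b r : ℕ) :
    ∃ x : EdgeNames b (2 * r * (2 * b + 1)), x.IsResilient r := by
  classical
  have : Fact (Nat.Prime 2) := ⟨Nat.prime_two⟩
  let F := GaloisField 2 (2 * b + 1)
  have : Finite F := inferInstance
  let : Fintype F := Fintype.ofFinite F
  have hcardF : Fintype.card F = 2 ^ (2 * b + 1) := by
    rw [← Nat.card_eq_fintype_card]
    exact GaloisField.card 2 _ (by omega)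
  have hle : Fintype.card (Sym2 (VertexId b)) ≤ Fintype.card F := by
    have h1 : Fintype.card (Sym2 (VertexId b)) ≤ Fintype.card (VertexId b × VertexId b) :=
      Fintype.card_le_of_surjective (fun p => s(p.1, p.2)) fun e => by
        induction e with
        | h i j => exact ⟨(i, j), rfl⟩
    rw [hcardF]
    refine h1.trans ?_
    simp only [Fintype.card_prod, Fintype.card_fun, Fintype.card_bool, Fintype.card_fin]
    rw [← pow_add]
    exact Nat.pow_le_pow_right (by norm_num) (by omega)
  obtain ⟨φ⟩ := Function.Embedding.nonempty_of_card_le hle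
  let ψ : F ≃ₗ[ZMod 2] (Fin (2 * b + 1) → ZMod 2) := LinearEquiv.ofFinrankEq _ _ (by
    rw [GaloisField.finrank 2 (by omega)]
    simp)
  refine ⟨fun e t => ψ (φ e ^ (finProdFinEquiv.symm t).1.val) (finProdFinEquiv.symm t).2, ?_⟩
  intro A B _ _ hA hB hAB hsum
  have hpow : ∀ i < 2 * r, ∑ e ∈ A, φ e ^ i = ∑ e ∈ B, φ e ^ i := by
    intro i hi
    apply ψ.injective
    ext q
    have := congrFun hsum (finProdFinEquiv (⟨i, hi⟩, q))
    simp only [Finset.sum_apply, Equiv.symm_apply_apply] at this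
    simpa [map_sum, Finset.sum_apply] using this
  have hsymm : ∀ f : Sym2 (VertexId b) → F, ∑ e ∈ A, f e = ∑ e ∈ B, f e →
      ∑ e ∈ symmDiff A B, f e = 0 := by
    intro f hf
    have h1 : ∑ e ∈ symmDiff A B, f e = ∑ e ∈ A \ B, f e + ∑ e ∈ B \ A, f e := by
      rw [symmDiff, Finset.sup_eq_union, Finset.sum_union disjoint_sdiff_sdiff]
    have h2 := Finset.sum_sdiff_sub_sum_sdiff (s₁ := B) (s₂ := A) (f := f)
    rw [h1, ← CharTwo.sub_eq_add, h2, hf, sub_self]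
  obtain ⟨e₀, he₀⟩ : (symmDiff A B).Nonempty := by
    rw [Finset.nonempty_iff_ne_empty, ← Finset.bot_eq_empty, Ne, symmDiff_eq_bot]
    exact hAB
  have hcard : (symmDiff A B).card ≤ 2 * r := by
    refine (Finset.card_le_card (symmDiff_le_sup (a := A) (b := B))).trans ?_
    exact (Finset.card_union_le A B).trans (by omega)
  have hpoly : ∀ p : Polynomial F, p.natDegree < 2 * r → ∑ e ∈ symmDiff A B, p.eval (φ e) = 0 := by
    intro p hp
    simp only [Polynomial.eval_eq_sum_range' hp]
    rw [Finset.sum_comm]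
    refine Finset.sum_eq_zero fun i hi => ?_
    rw [← Finset.mul_sum, hsymm _ (hpow i (Finset.mem_range.1 hi)), mul_zero]
  let p : Polynomial F := ∏ e ∈ (symmDiff A B).erase e₀, (Polynomial.X - Polynomial.C (φ e))
  have hdeg : p.natDegree < 2 * r := by
    have h1 : p.natDegree = ((symmDiff A B).erase e₀).card :=
      Polynomial.natDegree_finsetProd_X_sub_C_eq_card _ _
    rw [h1]
    exact (Finset.card_erase_lt_of_mem he₀).trans_le hcard
  have heval := hpoly p hdeg
  rw [Finset.sum_eq_single_of_mem e₀ he₀] at heval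
  · rw [Polynomial.eval_prod, Finset.prod_eq_zero_iff] at heval
    obtain ⟨e, he, h0⟩ := heval
    rw [Polynomial.eval_sub, Polynomial.eval_X, Polynomial.eval_C, sub_eq_zero] at h0
    exact Finset.ne_of_mem_erase he (φ.injective h0).symm
  · intro e he hne
    rw [Polynomial.eval_prod]
    exact Finset.prod_eq_zero (Finset.mem_erase.2 ⟨hne, he⟩) (by simp)

theorem card_finset_card_le {β : Type*} [Fintype β] (k : ℕ) :
    Nat.card {S : Finset β // S.card ≤ k} ≤ (Fintype.card β + 1) ^ k := by
  classical
  have hcard : Fintype.card (Fin k → Option β) = (Fintype.card β + 1) ^ k := by simp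
  rw [← hcard, ← Nat.card_eq_fintype_card]
  let f : {S : Finset β // S.card ≤ k} → Fin k → Option β := fun S i => S.1.toList[i.val]?
  refine Nat.card_le_card_of_injective f fun S T h => ?_
  have hlist : S.1.toList = T.1.toList := by
    refine List.ext_getElem? fun i => ?_
    by_cases hi : i < k
    · exact congrFun h ⟨i, hi⟩
    · rw [List.getElem?_eq_none, List.getElem?_eq_none]
      · rw [Finset.length_toList]
        exact T.2.trans (not_lt.1 hi)
      · rw [Finset.length_toList]
        exact S.2.trans (not_lt.1 hi)
  exact Subtype.ext (by rw [← Finset.toList_toFinset S.1, hlist, Finset.toList_toFinset])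

/-- At most `(2 ^ (2 * b + 1)) ^ k` sets of at most `k` pairs of identifiers exist. -/
theorem exists_injOn_encoding (b k l : ℕ) :
    ∃ enc : Finset (Sym2 (VertexId b)) × (Fin l → ZMod 2) → Fin ((2 * b + 1) * k + l) → Bool,
      Set.InjOn enc {p | p.1.card ≤ k} := by
  classical
  have hsym : Fintype.card (Sym2 (VertexId b)) + 1 ≤ 2 ^ (2 * b + 1) := by
    have h1 : Fintype.card (Sym2 (VertexId b)) ≤ Fintype.card (VertexId b × VertexId b) :=
      Fintype.card_le_of_surjective (fun p => s(p.1, p.2)) fun e => by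
        induction e with
        | h i j => exact ⟨(i, j), rfl⟩
    have h2 : Fintype.card (VertexId b × VertexId b) = 2 ^ (2 * b) := by
      simp [two_mul, pow_add]
    have h3 := Nat.one_le_two_pow (n := 2 * b)
    rw [pow_succ]
    omega
  have hcard : Fintype.card ({S : Finset (Sym2 (VertexId b)) // S.card ≤ k} × (Fin l → ZMod 2)) ≤
      Fintype.card (Fin ((2 * b + 1) * k + l) → Bool) := by
    have h1 := card_finset_card_le (β := Sym2 (VertexId b)) k
    rw [Nat.card_eq_fintype_card] at h1
    have h2 := h1.trans (Nat.pow_le_pow_left hsym k)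
    rw [← pow_mul] at h2
    simp only [Fintype.card_prod, Fintype.card_fun, Fintype.card_bool, Fintype.card_fin,
      ZMod.card, pow_add] at h2 ⊢
    exact Nat.mul_le_mul_right _ (by simpa [pow_add] using h2)
  obtain ⟨f⟩ := Function.Embedding.nonempty_of_card_le hcard
  refine ⟨fun p => if h : p.1.card ≤ k then f (⟨p.1, h⟩, p.2) else fun _ => false, ?_⟩
  intro p hp q hq h
  have hp' : p.1.card ≤ k := hp
  have hq' : q.1.card ≤ k := hq
  simp only [dif_pos hp', dif_pos hq'] at h
  have := f.injective h
  simp only [Prod.mk.injEq, Subtype.mk.injEq] at this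
  exact Prod.ext this.1 this.2

/-! ### Decoding -/

section Decoding

variable {b : ℕ} {V : Finset (VertexId b)}

/-- The edges of `G` between different connected components of `H`. -/
def crossGraph {W : Type*} (G H : SimpleGraph W) : SimpleGraph W where
  Adj u w := G.Adj u w ∧ ¬ H.Reachable u w
  symm := ⟨fun _ _ h => ⟨h.1.symm, fun hr => h.2 hr.symm⟩⟩
  loopless := ⟨fun _ h => h.1.ne rfl⟩

theorem reachable_sup_crossGraph {W : Type*} {G H : SimpleGraph W} {u w : W}
    (h : G.Reachable u w) : (H ⊔ crossGraph G H).Reachable u w := by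
  obtain ⟨p⟩ := h
  induction p with
  | nil => exact SimpleGraph.Reachable.refl _
  | @cons u v w huv p ih =>
    refine SimpleGraph.Reachable.trans ?_ ih
    by_cases hr : H.Reachable u v
    · exact hr.mono le_sup_left
    · exact SimpleGraph.Adj.reachable (Or.inr ⟨huv, hr⟩)

theorem IsSpanningForest.of_sup_crossGraph {W : Type*} {G H T : SimpleGraph W} (hH : H ≤ G)
    (hT : IsSpanningForest (H ⊔ crossGraph G H) T) : IsSpanningForest G T :=
  ⟨hT.1.trans (sup_le hH fun _ _ h => h.1), hT.2.1,
    fun u v huv => hT.2.2 u v (reachable_sup_crossGraph huv)⟩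

theorem sampledGraph_le {G : SimpleGraph V} {σ : V → Finset (Sym2 (VertexId b))}
    (h : ∀ v, σ v ⊆ edgesAt G v) : sampledGraph σ ≤ G := by
  rintro u w ⟨-, v, hv⟩
  obtain ⟨t, ht, he⟩ := mem_edgesAt.1 (h v hv)
  rcases Sym2.eq_iff.1 he with ⟨h1, h2⟩ | ⟨h1, h2⟩
  · rwa [Subtype.ext h1, Subtype.ext h2] at ht
  · rw [Subtype.ext h1, Subtype.ext h2] at ht
    exact ht.symm

open Classical in
/-- The pairs of adjacent vertices with the first one inside and the second one outside of `S`. -/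
noncomputable def boundaryPairs (G : SimpleGraph V) (S : Finset V) : Finset (V × V) :=
  {p | p.1 ∈ S ∧ p.2 ∉ S ∧ G.Adj p.1 p.2}

open Classical in
/-- The edges between `S` and its complement. -/
noncomputable def boundary (G : SimpleGraph V) (S : Finset V) : Finset (Sym2 (VertexId b)) :=
  (boundaryPairs G S).image fun p => s(p.1.1, p.2.1)

theorem mem_boundaryPairs {G : SimpleGraph V} {S : Finset V} {p : V × V} :
    p ∈ boundaryPairs G S ↔ p.1 ∈ S ∧ p.2 ∉ S ∧ G.Adj p.1 p.2 := by
  simp [boundaryPairs]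

theorem eq_or_swap_of_edge_eq {p q : V × V} (h : s(p.1.1, p.2.1) = s(q.1.1, q.2.1)) :
    p = q ∨ p = q.swap := by
  rcases Sym2.eq_iff.1 h with ⟨h1, h2⟩ | ⟨h1, h2⟩
  · exact Or.inl (Prod.ext (Subtype.ext h1) (Subtype.ext h2))
  · exact Or.inr (Prod.ext (Subtype.ext h1) (Subtype.ext h2))

theorem edge_mem_boundary {G : SimpleGraph V} {S : Finset V} {u w : V} (hu : u ∈ S) (hw : w ∉ S) :
    s(u.1, w.1) ∈ boundary G S ↔ G.Adj u w := by
  rw [boundary, Finset.mem_image]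
  constructor
  · rintro ⟨p, hp, he⟩
    rw [mem_boundaryPairs] at hp
    rcases eq_or_swap_of_edge_eq (q := (u, w)) he with rfl | rfl
    · exact hp.2.2
    · exact absurd hp.1 hw
  · exact fun h => ⟨(u, w), mem_boundaryPairs.2 ⟨hu, hw, h⟩, rfl⟩

theorem boundary_subset {G : SimpleGraph V} {S : Finset V} :
    boundary G S ⊆ (⊤ : SimpleGraph (VertexId b)).edgeFinset := by
  intro e he
  obtain ⟨p, hp, rfl⟩ := Finset.mem_image.1 he
  rw [mem_boundaryPairs] at hp
  rw [SimpleGraph.mem_edgeFinset, SimpleGraph.mem_edgeSet, SimpleGraph.top_adj]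
  exact fun h => hp.2.2.ne (Subtype.ext h)

/-- In the sum of the exclusive ors at the vertices of `S`, the edges inside `S` cancel. -/
theorem sum_edgesAt_eq_sum_boundary {l : ℕ} (x : EdgeNames b l) (G : SimpleGraph V)
    (S : Finset V) : ∑ v ∈ S, ∑ e ∈ edgesAt G v, x e = ∑ e ∈ boundary G S, x e := by
  classical
  have hself : ∀ y : Fin l → ZMod 2, y + y = 0 := fun y => by
    ext i
    exact CharTwo.add_self_eq_zero _
  have h1 : ∑ v ∈ S, ∑ e ∈ edgesAt G v, x e =
      ∑ p : V × V with p.1 ∈ S ∧ G.Adj p.1 p.2, x s(p.1.1, p.2.1) := by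
    have hL : ∀ v, ∑ e ∈ edgesAt G v, x e = ∑ u with G.Adj v u, x s(v.1, u.1) := by
      intro v
      rw [edgesAt_eq_image, Finset.sum_image fun u _ w _ h => edge_injective v h]
    simp only [hL, Finset.sum_filter]
    rw [Fintype.sum_prod_type, ← Finset.sum_filter_add_sum_filter_not Finset.univ (· ∈ S)]
    rw [Finset.sum_eq_zero (s := {v | v ∉ S}), add_zero]
    · rw [Finset.filter_univ_mem]
      refine Finset.sum_congr rfl fun v hv => Finset.sum_congr rfl fun u _ => ?_
      simp [hv]
    · intro v hv
      rw [Finset.mem_filter_univ] at hv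
      exact Finset.sum_eq_zero fun u _ => if_neg fun h => hv h.1
  have h2 : ∑ p : V × V with (p.1 ∈ S ∧ G.Adj p.1 p.2) ∧ p.2 ∈ S, x s(p.1.1, p.2.1) = 0 := by
    refine Finset.sum_involution (fun p _ => p.swap) ?_ ?_ ?_ ?_
    · intro p _
      rw [Prod.fst_swap, Prod.snd_swap, Sym2.eq_swap]
      exact hself _
    · intro p hp _ h
      rw [Finset.mem_filter_univ] at hp
      exact hp.1.2.ne (congrArg Prod.snd h)
    · intro p hp
      rw [Finset.mem_filter_univ] at hp ⊢
      exact ⟨⟨hp.2, hp.1.2.symm⟩, hp.1.1⟩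
    · intro p _
      exact p.swap_swap
  rw [h1, ← Finset.sum_filter_add_sum_filter_not _ (fun p : V × V => p.2 ∈ S),
    Finset.filter_filter, Finset.filter_filter, h2, zero_add, boundary, Finset.sum_image]
  · refine Finset.sum_congr ?_ fun _ _ => rfl
    ext p
    rw [mem_boundaryPairs, Finset.mem_filter_univ]
    tauto
  · intro p hp q hq h
    rw [Finset.mem_coe, mem_boundaryPairs] at hp hq
    rcases eq_or_swap_of_edge_eq h with h | rfl
    · exact h
    · exact absurd hp.1 hq.2.1

theorem card_boundary_le {G H : SimpleGraph V} {S : Finset V}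
    (hS : ∀ u ∈ S, ∀ w ∉ S, ¬ H.Reachable u w) : (boundary G S).card ≤ crossing G H := by
  classical
  have h1 : crossing G H = (Finset.univ.sigma fun v => crossNbrs G H v).card := by
    rw [Finset.card_sigma, crossing]
  rw [h1]
  refine Finset.card_image_le.trans (Finset.card_le_card_of_injOn (fun p => ⟨p.1, p.2⟩) ?_ ?_)
  · intro p hp
    rw [Finset.mem_coe, mem_boundaryPairs] at hp
    simp only [Finset.coe_sigma, Set.mem_sigma_iff, Finset.coe_univ, Set.mem_univ, true_and,
      Finset.mem_coe]
    exact mem_crossNbrs.2 ⟨hp.2.2, hS _ hp.1 _ hp.2.1⟩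
  · intro p _ q _ h
    simp only [Sigma.mk.injEq, heq_eq_eq] at h
    exact Prod.ext h.1 h.2

/-- The exclusive ors of the names determine the crossing edges, if there are few of them. -/
theorem crossGraph_le_of_sum_eq {l r : ℕ} {x : EdgeNames b l} (hx : x.IsResilient r)
    {G G' H : SimpleGraph V} (hG : crossing G H ≤ r) (hG' : crossing G' H ≤ r)
    (hsum : ∀ v, ∑ e ∈ edgesAt G v, x e = ∑ e ∈ edgesAt G' v, x e) :
    crossGraph G H ≤ crossGraph G' H := by
  classical
  rintro u w ⟨hadj, hr⟩
  refine ⟨?_, hr⟩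
  let S : Finset V := {w | H.Reachable u w}
  have hS : ∀ v ∈ S, ∀ w ∉ S, ¬ H.Reachable v w := by
    intro v hv w hw hvw
    rw [Finset.mem_filter_univ] at hv hw
    exact hw (hv.trans hvw)
  have hu : u ∈ S := by simp [S]
  have hw : w ∉ S := by simpa [S] using hr
  have heq : boundary G S = boundary G' S := by
    by_contra hne
    refine hx _ _ boundary_subset boundary_subset ((card_boundary_le hS).trans hG)
      ((card_boundary_le hS).trans hG') hne ?_
    rw [← sum_edgesAt_eq_sum_boundary, ← sum_edgesAt_eq_sum_boundary]
    exact Finset.sum_congr rfl fun v _ => hsum v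
  rwa [← edge_mem_boundary hu hw, ← heq, edge_mem_boundary hu hw]

variable {l L : ℕ}

/-- The messages `M` may have been sent by the vertices of the graph `G` with the samples `σ`, which
leave at most `r` crossing pairs. -/
structure Explains (k r : ℕ) (x : EdgeNames b l)
    (enc : Finset (Sym2 (VertexId b)) × (Fin l → ZMod 2) → Fin L → Bool)
    (M : VertexId b → Option (Fin L → Bool)) (V : Finset (VertexId b)) (G : SimpleGraph V)
    (σ : V → Finset (Sym2 (VertexId b))) : Prop where
  subset : ∀ v, σ v ⊆ edgesAt G v
  card_le : ∀ v, (σ v).card ≤ k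
  crossing_le : crossing G (sampledGraph σ) ≤ r
  messages : M = fun i => if h : i ∈ V then
    some (enc (σ ⟨i, h⟩, ∑ e ∈ edgesAt G ⟨i, h⟩, x e)) else none

/-- The set `A` is the edge set of a spanning forest of the sampled and the crossing edges, for some
explanation of the messages `M`. -/
def IsAnswer (k r : ℕ) (x : EdgeNames b l)
    (enc : Finset (Sym2 (VertexId b)) × (Fin l → ZMod 2) → Fin L → Bool)
    (M : VertexId b → Option (Fin L → Bool)) (A : Finset (Sym2 (VertexId b))) : Prop :=
  ∃ (V : Finset (VertexId b)) (G : SimpleGraph V) (σ : V → Finset (Sym2 (VertexId b)))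
    (T : SimpleGraph V), Explains k r x enc M V G σ ∧
    IsSpanningForest (sampledGraph σ ⊔ crossGraph G (sampledGraph σ)) T ∧
    (A : Set (Sym2 (VertexId b))) = Sym2.map Subtype.val '' T.edgeSet

open Classical in
/-- The referee that outputs an answer, if there is one. -/
noncomputable def answerReferee (k r : ℕ) (x : EdgeNames b l)
    (enc : Finset (Sym2 (VertexId b)) × (Fin l → ZMod 2) → Fin L → Bool)
    (M : VertexId b → Option (Fin L → Bool)) : Finset (Sym2 (VertexId b)) :=
  if h : ∃ A, IsAnswer k r x enc M A then h.choose else ∅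

/-- All explanations of the same messages have the same sampled and the same crossing edges, so every
answer is a spanning forest of the actual graph. -/
theorem exists_isSpanningForest_answerReferee {k r : ℕ} {x : EdgeNames b l} (hx : x.IsResilient r)
    {enc : Finset (Sym2 (VertexId b)) × (Fin l → ZMod 2) → Fin L → Bool}
    (henc : Set.InjOn enc {p | p.1.card ≤ k}) {M : VertexId b → Option (Fin L → Bool)}
    {G : SimpleGraph V} {σ : V → Finset (Sym2 (VertexId b))} (h : Explains k r x enc M V G σ) :
    ∃ T : SimpleGraph V, IsSpanningForest G T ∧
      (answerReferee k r x enc M : Set (Sym2 (VertexId b))) =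
        Sym2.map Subtype.val '' T.edgeSet := by
  classical
  have hex : ∃ A, IsAnswer k r x enc M A := by
    obtain ⟨T, hT, hac, hreach⟩ := SimpleGraph.exists_isAcyclic_reachable_eq_le
      (G := sampledGraph σ ⊔ crossGraph G (sampledGraph σ))
    refine ⟨(Sym2.map Subtype.val '' T.edgeSet).toFinite.toFinset, V, G, σ, T, h, ⟨hT, hac, ?_⟩,
      by simp⟩
    intro u v huv
    rwa [hreach]
  rw [answerReferee, dif_pos hex]
  obtain ⟨V', G', σ', T, h', hT, hA⟩ := hex.choose_spec
  have hM := h.messages.symm.trans h'.messages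
  obtain rfl : V = V' := by
    ext i
    have := congrFun hM i
    by_cases h1 : i ∈ V <;> by_cases h2 : i ∈ V' <;> simp_all
  have heq : ∀ v : V, (σ v, ∑ e ∈ edgesAt G v, x e) = (σ' v, ∑ e ∈ edgesAt G' v, x e) := by
    intro v
    have := congrFun hM v.1
    simp only [dif_pos v.2, Option.some.injEq] at this
    exact henc (h.card_le v) (h'.card_le v) this
  obtain rfl : σ = σ' := funext fun v => (Prod.ext_iff.1 (heq v)).1
  have hsum : ∀ v, ∑ e ∈ edgesAt G v, x e = ∑ e ∈ edgesAt G' v, x e := fun v =>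
    (Prod.ext_iff.1 (heq v)).2
  have hcross : crossGraph G' (sampledGraph σ) = crossGraph G (sampledGraph σ) :=
    le_antisymm
      (crossGraph_le_of_sum_eq hx h'.crossing_le h.crossing_le fun v => (hsum v).symm)
      (crossGraph_le_of_sum_eq hx h.crossing_le h'.crossing_le hsum)
  rw [hcross] at hT
  exact ⟨T, hT.of_sup_crossGraph (sampledGraph_le h.subset), hA⟩

/-- The protocol fails only if the samples leave too many crossing edges. -/
theorem one_sub_le_successProb {k r : ℕ} {x : EdgeNames b l} (hx : x.IsResilient r)
    {enc : Finset (Sym2 (VertexId b)) × (Fin l → ZMod 2) → Fin L → Bool}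
    (henc : Set.InjOn enc {p | p.1.card ≤ k}) (G : SimpleGraph V) {ε : ℝ≥0∞}
    (hε : (PMF.pi fun v => kOutSample k (edgesAt G v)).toOuterMeasure
      {σ | (r : ℝ) < crossing G (sampledGraph σ)} ≤ ε) :
    1 - ε ≤ (sampleXorProtocol k x enc (answerReferee k r x enc)).successProb G := by
  classical
  set p := PMF.pi fun v => kOutSample k (edgesAt G v) with hp
  have hlaw : (sampleXorProtocol k x enc (answerReferee k r x enc)).messageLaw G =
      (p.map fun σ v => enc (σ v, ∑ e ∈ edgesAt G v, x e)).toMeasure := by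
    rw [hp, ← PMF.pi_map (fun v => kOutSample k (edgesAt G v))
      (fun v S => enc (S, ∑ e ∈ edgesAt G v, x e)), ← PMF.measure_pi_toMeasure]
    rfl
  rw [OneWayProtocol.successProb, hlaw, PMF.toMeasure_apply_eq_toOuterMeasure,
    PMF.toOuterMeasure_map_apply]
  set A := {σ : V → Finset (Sym2 (VertexId b)) | (r : ℝ) < crossing G (sampledGraph σ)} with hA
  have h1 : 1 - ε ≤ p.toOuterMeasure Aᶜ := by
    rw [tsub_le_iff_left, ← p.toOuterMeasure_compl_add A]
    gcongr
  refine h1.trans (PMF.toOuterMeasure_mono _ ?_)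
  rintro σ ⟨hσ, hsupp⟩
  have hσ' : crossing G (sampledGraph σ) ≤ r := by
    rw [hA, Set.mem_compl_iff, Set.mem_ofPred_eq, not_lt] at hσ
    exact_mod_cast hσ
  have hsample := fun v => mem_support_kOutSample.1 (PMF.mem_support_of_mem_support_pi hsupp v)
  exact exists_isSpanningForest_answerReferee hx henc (σ := σ) (G := G)
    ⟨fun v => (hsample v).1, fun v => (hsample v).2.trans_le (min_le_left _ _), hσ', rfl⟩

end Decoding

/-! ### Parameters -/

/-- `toOuterMeasure_pi_kOutSample_le` with rounds of length `k / 3 ≥ k / 5`, for `k ≥ 3`. The constants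
are `105 = 5 * (1 + 4 + 16)` and `8000 = 5 ^ 3 * 64`. -/
theorem toOuterMeasure_pi_kOutSample_le_of_le {b : ℕ} {V : Finset (VertexId b)} {G : SimpleGraph V}
    (hV : 0 < V.card) {k : ℕ} (hk : 3 ≤ k) {s t R : ℝ} (hs : 0 ≤ s) (ht : 0 < t) (htk : t ≤ k)
    (hR : 105 * (4 * V.card * (1 + s)) / t + 8000 * V.card ^ 2 / t ^ 3 ≤ R) :
    (PMF.pi fun v => kOutSample k (edgesAt G v)).toOuterMeasure
      {τ | R < crossing G (sampledGraph τ)} ≤ ENNReal.ofReal (3 * Real.exp (-s)) := by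
  have hcard : Fintype.card V = V.card := Fintype.card_coe V
  rw [ENNReal.ofReal_mul (by norm_num), ENNReal.ofReal_ofNat]
  refine toOuterMeasure_pi_kOutSample_le (by rwa [hcard]) (m := k / 3) (by omega) (by omega) ?_
  rw [hcard]
  refine le_trans ?_ hR
  have hm1 : (1 : ℝ) ≤ (k / 3 : ℕ) := by exact_mod_cast (by omega : 1 ≤ k / 3)
  have hm5 : t / 5 ≤ (k / 3 : ℕ) := by
    have h : (k : ℝ) ≤ 5 * (k / 3 : ℕ) := by exact_mod_cast (by omega : k ≤ 5 * (k / 3))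
    linarith
  generalize ((k / 3 : ℕ) : ℝ) = m at *
  set B : ℝ := 4 * V.card * (1 + s) with hB
  have hB0 : 0 ≤ B := by positivity
  have hm0 : 0 < m := by linarith
  have h2 : 4 * B / m ^ 2 ≤ 4 * B / m := by
    gcongr
    exact le_self_pow₀ hm1 (by norm_num)
  have h3 : 16 * B / m ^ 3 ≤ 16 * B / m := by
    gcongr
    exact le_self_pow₀ hm1 (by norm_num)
  have h4 : 21 * B / m ≤ 21 * B / (t / 5) := by gcongr
  have h5 : 64 * (V.card : ℝ) ^ 2 / m ^ 3 ≤ 64 * (V.card : ℝ) ^ 2 / (t / 5) ^ 3 := by gcongr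
  have e1 : 21 * B / (t / 5) = 105 * B / t := by field_simp; ring
  have e2 : 64 * (V.card : ℝ) ^ 2 / (t / 5) ^ 3 = 8000 * (V.card : ℝ) ^ 2 / t ^ 3 := by
    field_simp
    norm_num
  have e3 : 21 * B / m = B / m + 4 * B / m + 16 * B / m := by ring
  linarith

theorem half_le_log {n : ℕ} (hn : 2 ≤ n) : 1 / 2 ≤ Real.log n := by
  have h1 : Real.log 2 ≤ Real.log n := Real.log_le_log (by norm_num) (by exact_mod_cast hn)
  linarith [Real.log_two_gt_d9]

/-- The length of a message with a sample of at most `k` edges and names of `2 * r * (2 * b + 1)`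
bits. -/
theorem messageLength_le {n b k r : ℕ} (hn : 2 ≤ n) {d K w : ℝ} (hb : (b : ℝ) ≤ d * Real.log n)
    (hkr : (k : ℝ) + 2 * r ≤ K * w) :
    (((2 * b + 1) * k + 2 * r * (2 * b + 1) : ℕ) : ℝ) ≤ (2 * d + 2) * K * (w * Real.log n) := by
  have hlog := half_le_log hn
  have h1 : 2 * (b : ℝ) + 1 ≤ (2 * d + 2) * Real.log n := by linarith
  have h0 : 0 ≤ 2 * (b : ℝ) + 1 := by positivity
  push_cast
  calc (2 * (b : ℝ) + 1) * k + 2 * r * (2 * b + 1) = (2 * (b : ℝ) + 1) * (k + 2 * r) := by ring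
    _ ≤ ((2 * d + 2) * Real.log n) * (K * w) := by
        apply mul_le_mul h1 hkr (by positivity) (h0.trans h1)
    _ = _ := by ring

theorem half_le_successProb_of_sqrt {b n l L : ℕ} (hn : 2 ≤ n) {c : ℝ} (hc : 10000 ≤ c)
    {x : EdgeNames b l} (hx : x.IsResilient ⌈c * √n⌉₊)
    {enc : Finset (Sym2 (VertexId b)) × (Fin l → ZMod 2) → Fin L → Bool}
    (henc : Set.InjOn enc {p | p.1.card ≤ ⌈√n⌉₊}) {V : Finset (VertexId b)} (hV : V.card = n)
    (G : SimpleGraph V) :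
    1 / 2 ≤ (sampleXorProtocol ⌈√n⌉₊ x enc
      (answerReferee ⌈√n⌉₊ ⌈c * √n⌉₊ x enc)).successProb G := by
  have hhalf : (1 / 2 : ℝ≥0∞) = 1 - 1 / 2 := by
    rw [one_div, ENNReal.one_sub_inv_two]
  have hn2 : (2 : ℝ) ≤ n := by exact_mod_cast hn
  have hsq : √(n : ℝ) ^ 2 = n := Real.sq_sqrt (by positivity)
  have hy : 0 < √(n : ℝ) := Real.sqrt_pos.2 (by linarith)
  have hceil : c * √(n : ℝ) ≤ (⌈c * √(n : ℝ)⌉₊ : ℝ) := Nat.le_ceil _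
  have hk : √(n : ℝ) ≤ (⌈√(n : ℝ)⌉₊ : ℝ) := Nat.le_ceil _
  rw [hhalf]
  refine one_sub_le_successProb hx henc G ?_
  rcases le_or_gt 3 ⌈√(n : ℝ)⌉₊ with h3 | h3
  · refine (toOuterMeasure_pi_kOutSample_le_of_le (hV ▸ by omega) h3 (s := 2) (by norm_num) hy hk
      ?_).trans ?_
    · rw [hV]
      refine le_trans ?_ hceil
      generalize √(n : ℝ) = y at *
      rw [← hsq]
      have : 105 * (4 * y ^ 2 * (1 + 2)) / y + 8000 * (y ^ 2) ^ 2 / y ^ 3 = 9260 * y := by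
        field_simp
        norm_num
      rw [this]
      gcongr
      linarith
    · have hexp : 3 * Real.exp (-2) ≤ 1 / 2 := by
        have h1 : (6 : ℝ) ≤ Real.exp 2 := by
          have h2 : Real.exp 2 = Real.exp 1 * Real.exp 1 := by rw [← Real.exp_add]; norm_num
          rw [h2]
          nlinarith [Real.exp_one_gt_d9]
        rw [Real.exp_neg, ← div_eq_mul_inv, div_le_div_iff₀ (by positivity) (by norm_num)]
        linarith
      refine (ENNReal.ofReal_le_ofReal hexp).trans_eq ?_
      rw [ENNReal.ofReal_div_of_pos (by norm_num)]
      simp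
  -- If `k ≤ 2`, then `n ≤ 4`, and there are at most `n ^ 2 ≤ r` crossing pairs.
  · refine le_trans (le_of_eq ?_) (zero_le (a := (1 / 2 : ℝ≥0∞)))
    have hempty : {σ : V → Finset (Sym2 (VertexId b)) |
        ((⌈c * √(n : ℝ)⌉₊ : ℕ) : ℝ) < crossing G (sampledGraph σ)} = ∅ := by
      rw [Set.eq_empty_iff_forall_notMem]
      intro σ hσ
      rw [Set.mem_ofPred_eq] at hσ
      have h1 : (crossing G (sampledGraph σ) : ℝ) ≤ (n : ℝ) ^ 2 := by
        rw [← hV, ← Fintype.card_coe V]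
        exact_mod_cast crossing_le_sq G _
      have h2 : √(n : ℝ) ≤ 2 := by
        have : (⌈√(n : ℝ)⌉₊ : ℝ) ≤ 2 := by exact_mod_cast (by omega)
        linarith
      generalize √(n : ℝ) = y at *
      rw [← hsq] at h1
      have h4 : (y ^ 2) ^ 2 ≤ 8 * y := by
        have : y ^ 3 ≤ 2 ^ 3 := by gcongr
        nlinarith
      nlinarith
    rw [hempty]
    exact MeasureTheory.measure_empty

theorem one_sub_rpow_le_successProb {b n l L : ℕ} (hn : 2 ≤ n) {α a : ℝ} (hα : 0 < α)
    (ha : 1000 * (α + 4) ≤ a) {x : EdgeNames b l}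
    (hx : x.IsResilient ⌈a * √(n * Real.log n)⌉₊)
    {enc : Finset (Sym2 (VertexId b)) × (Fin l → ZMod 2) → Fin L → Bool}
    (henc : Set.InjOn enc {p | p.1.card ≤ ⌈a * √(n * Real.log n)⌉₊}) {V : Finset (VertexId b)}
    (hV : V.card = n) (G : SimpleGraph V) :
    1 - ENNReal.ofReal ((n : ℝ) ^ (-α)) ≤ (sampleXorProtocol ⌈a * √(n * Real.log n)⌉₊ x enc
      (answerReferee ⌈a * √(n * Real.log n)⌉₊ ⌈a * √(n * Real.log n)⌉₊ x enc)).successProb G := by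
  have hn2 : (2 : ℝ) ≤ n := by exact_mod_cast hn
  have hlog := half_le_log hn
  have hsq : √(n * Real.log n : ℝ) ^ 2 = n * Real.log n := Real.sq_sqrt (by positivity)
  have hw : 1 ≤ √(n * Real.log n : ℝ) := by
    rw [Real.one_le_sqrt]
    nlinarith
  refine one_sub_le_successProb hx henc G ?_
  have hceil := Nat.le_ceil (a * √(n * Real.log n))
  have ha0 : 4000 ≤ a := by linarith
  have h3 : 3 ≤ ⌈a * √(n * Real.log n)⌉₊ := by
    have : (3 : ℝ) ≤ (⌈a * √(n * Real.log n)⌉₊ : ℝ) := by nlinarith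
    exact_mod_cast this
  refine (toOuterMeasure_pi_kOutSample_le_of_le (hV ▸ by omega) h3 (s := (α + 2) * Real.log n)
    (by positivity) (t := a * √(n * Real.log n)) (by positivity) hceil ?_).trans ?_
  · rw [hV]
    refine le_trans ?_ hceil
    have hB : 4 * (n : ℝ) * (1 + (α + 2) * Real.log n) ≤ 4 * (α + 4) * √(n * Real.log n) ^ 2 := by
      rw [hsq]
      nlinarith
    have hN : (n : ℝ) ^ 2 ≤ 4 * √(n * Real.log n) ^ 4 := by
      have h1 : (n : ℝ) ≤ 2 * √(n * Real.log n) ^ 2 := by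
        rw [hsq]
        nlinarith
      calc (n : ℝ) ^ 2 ≤ (2 * √(n * Real.log n) ^ 2) ^ 2 := by gcongr
        _ = _ := by ring
    generalize √(n * Real.log n) = w at *
    have ha1 : 420 * (α + 4) / a ≤ 1 := by
      rw [div_le_one (by linarith)]
      linarith
    have ha3 : 32000 / a ^ 3 ≤ 1 := by
      rw [div_le_one (by positivity)]
      calc (32000 : ℝ) ≤ 4000 ^ 3 := by norm_num
        _ ≤ a ^ 3 := by gcongr
    calc 105 * (4 * (n : ℝ) * (1 + (α + 2) * Real.log n)) / (a * w) +
          8000 * (n : ℝ) ^ 2 / (a * w) ^ 3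
        ≤ 105 * (4 * (α + 4) * w ^ 2) / (a * w) + 8000 * (4 * w ^ 4) / (a * w) ^ 3 := by
          gcongr
      _ = (420 * (α + 4) / a + 32000 / a ^ 3) * w := by
          field_simp
          ring
      _ ≤ a * w := by
          gcongr
          linarith
  · refine ENNReal.ofReal_le_ofReal ?_
    have hn0 : (0 : ℝ) < n := by linarith
    have h1 : (3 : ℝ) ≤ Real.exp (2 * Real.log n) := by
      rw [two_mul, Real.exp_add, Real.exp_log hn0]
      nlinarith
    rw [Real.rpow_def_of_pos hn0]
    calc 3 * Real.exp (-((α + 2) * Real.log n))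
        ≤ Real.exp (2 * Real.log n) * Real.exp (-((α + 2) * Real.log n)) := by gcongr
      _ = Real.exp (Real.log n * -α) := by
          rw [← Real.exp_add]
          congr 1
          ring

theorem mainTheorem7 :
    -- constant success probability
    (∃ c₀ : ℝ, ∀ c : ℝ, c₀ ≤ c → ∀ d : ℝ, ∃ C : ℝ, ∀ n b : ℕ, 2 ≤ n → (b : ℝ) ≤ d * Real.log n →
      ∃ (l L : ℕ) (x : EdgeNames b l)
        (enc : Finset (Sym2 (VertexId b)) × (Fin l → ZMod 2) → Fin L → Bool)
        (referee : (VertexId b → Option (Fin L → Bool)) → Finset (Sym2 (VertexId b))),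
        (L : ℝ) ≤ C * (√n * Real.log n) ∧
        x.IsResilient ⌈c * √n⌉₊ ∧
        Set.InjOn enc {p | p.1.card ≤ ⌈√n⌉₊} ∧
        ∀ V : Finset (VertexId b), V.card = n → ∀ G : SimpleGraph V,
          1 / 2 ≤ (sampleXorProtocol ⌈√n⌉₊ x enc referee).successProb G) ∧
    -- polynomially small failure probability
    (∀ α : ℝ, 0 < α →
      ∃ a₀ : ℝ, ∀ a : ℝ, a₀ ≤ a → ∀ d : ℝ, ∃ C : ℝ, ∀ n b : ℕ, 2 ≤ n → (b : ℝ) ≤ d * Real.log n →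
      ∃ (l L : ℕ) (x : EdgeNames b l)
        (enc : Finset (Sym2 (VertexId b)) × (Fin l → ZMod 2) → Fin L → Bool)
        (referee : (VertexId b → Option (Fin L → Bool)) → Finset (Sym2 (VertexId b))),
        (L : ℝ) ≤ C * (√(n * Real.log n) * Real.log n) ∧
        x.IsResilient ⌈a * √(n * Real.log n)⌉₊ ∧
        Set.InjOn enc {p | p.1.card ≤ ⌈a * √(n * Real.log n)⌉₊} ∧
        ∀ V : Finset (VertexId b), V.card = n → ∀ G : SimpleGraph V,
          1 - ENNReal.ofReal ((n : ℝ) ^ (-α)) ≤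
            (sampleXorProtocol ⌈a * √(n * Real.log n)⌉₊ x enc referee).successProb G) := by
  refine ⟨⟨10000, fun c hc d => ⟨(2 * d + 2) * (2 + 2 * (c + 1)), fun n b hn hb => ?_⟩⟩,
    fun α hα => ⟨1000 * (α + 4), fun a ha d =>
      ⟨(2 * d + 2) * (3 * (a + 1)), fun n b hn hb => ?_⟩⟩⟩
  · obtain ⟨x, hx⟩ := exists_isResilient b ⌈c * √(n : ℝ)⌉₊
    obtain ⟨enc, henc⟩ := exists_injOn_encoding b ⌈√(n : ℝ)⌉₊
      (2 * ⌈c * √(n : ℝ)⌉₊ * (2 * b + 1))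
    refine ⟨_, _, x, enc, answerReferee ⌈√(n : ℝ)⌉₊ ⌈c * √(n : ℝ)⌉₊ x enc, ?_, hx, henc,
      fun V hV G => half_le_successProb_of_sqrt hn hc hx henc hV G⟩
    have hy : 1 ≤ √(n : ℝ) := by
      rw [Real.one_le_sqrt]
      exact_mod_cast (by omega : 1 ≤ n)
    refine messageLength_le hn hb ?_
    have h1 := Nat.ceil_lt_add_one (Real.sqrt_nonneg (n : ℝ))
    have h2 := Nat.ceil_lt_add_one (a := c * √(n : ℝ)) (by positivity)
    linarith
  · obtain ⟨x, hx⟩ := exists_isResilient b ⌈a * √(n * Real.log n)⌉₊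
    obtain ⟨enc, henc⟩ := exists_injOn_encoding b ⌈a * √(n * Real.log n)⌉₊
      (2 * ⌈a * √(n * Real.log n)⌉₊ * (2 * b + 1))
    refine ⟨_, _, x, enc,
      answerReferee ⌈a * √(n * Real.log n)⌉₊ ⌈a * √(n * Real.log n)⌉₊ x enc, ?_, hx, henc,
      fun V hV G => one_sub_rpow_le_successProb hn hα ha hx henc hV G⟩
    have hw : 1 ≤ √(n * Real.log n) := by
      rw [Real.one_le_sqrt]
      have hn2 : (2 : ℝ) ≤ n := by exact_mod_cast hn
      nlinarith [half_le_log hn]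
    have ha0 : 0 ≤ a := by linarith
    refine messageLength_le hn hb ?_
    have h1 := Nat.ceil_lt_add_one (a := a * √(n * Real.log n)) (by positivity)
    linarith
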